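/- For a finite connected simple graph $G$, an edge $e=uv$ of $G$ and an edge $f=ab$ of $G$, let $d(f,u)=\min\{d(a,u),d(b,u)\}$, let $m_u(e|G)$ be the number of edges $f$ of $G$ with $d(f,u)<d(f,v)$, define $m_v(e|G)$ symmetrically, and let $$Mo_e(G)=\sum_{e=uv\in E(G)}|m_u(e|G)-m_v(e|G)|$$ be the edge Mostar index of $G$. A connected graph is bicyclic if it has exactly one more edge than vertices; its size is its number of edges. Let $\Theta(a,b,c)$ be the graph formed by three internally disjoint paths of lengths $a,b,c$ between the same two vertices. Define the following graphs of size $m$: - $B_m$ ($m\ge 8$): two 4-cycles sharing one vertex, with $m-8$ pendent edges attached at that vertex; - $B^1_m$ ($m\ge 7$): a 4-cycle and a triangle sharing one vertex, with $m-7$ pendent edges attached at that vertex; - $B^2_m$ ($m\ge 6$): two triangles sharing one vertex, with $m-6$ pendent edges attached at that vertex; - $B^3_m$ and $B^4_m$ ($m\ge 5$): $\Theta(1,2,2)$ ($K_4$ minus an edge) with $m-5$ pendent edges attached at one vertex of degree 3, respectively of degree 2, of $\Theta(1,2,2)$; - $B^5_m$ ($m\ge 6$): $\Theta(2,2,2)=K_{2,3}$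 with $m-6$ pendent edges attached at one vertex of degree 2 of $\Theta(2,2,2)$. **Theorem.** Let $G$ be a bicyclic graph of size $m\ge 5$. Then $$Mo_e(G)\le\begin{cases}4, & m=5,\text{ with equality iff } G\cong B^3_m \text{ or } G\cong B^4_m \text{ (these two coincide)};\\ m^2-3m-6, & 6\le m\le 8,\text{ with equality iff } G\cong B^2_m\text{ or }G\cong B^3_m;\\ 48, & m=9,\text{ with equality iff } G\cong B_m,\ B^1_m,\ B^2_m,\ B^3_m\text{ or } B^4_m;\\ m^2-m-24, & m\ge 10,\text{ with equality iff } G\cong B_m.\end{cases}$$ In particular, for every $m\ge 10$, $B_m$ has the maximum edge Mostar index among all bicyclic graphs of size $m$, whereas $B^5_m$ is a bicyclic graph of size $m$ that does not. This disproves the conjecture of Liu et al. that, for all sufficiently large $m$, both $B_m$ and $B^5_m$ have the maximum edge Mostar index among bicyclic graphs of size $m$. -/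

import Mathlib

namespace EdgeMostar

/-- The distance from the edge `f` to the vertex `w`: the smaller of the distances from the two
ends of `f` to `w`. -/
noncomputable def edgeDist {V : Type*} (G : SimpleGraph V) (f : Sym2 V) (w : V) : ℕ :=
  Sym2.lift ⟨fun a b => min (G.dist a w) (G.dist b w), fun _ _ => min_comm _ _⟩ f

open Classical in
/-- The number of edges of `G` that lie closer to `u` than to `v`. -/
noncomputable def closerEdges {V : Type*} [Fintype V] (G : SimpleGraph V) (u v : V) : ℕ :=
  (G.edgeFinset.filter fun f => edgeDist G f u < edgeDist G f v).card

/-- The contribution `|m_u(e|G) - m_v(e|G)|` of `e = uv`. -/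
noncomputable def contribution {V : Type*} [Fintype V] (G : SimpleGraph V) (e : Sym2 V) : ℤ :=
  Sym2.lift ⟨fun u v => |(closerEdges G u v : ℤ) - (closerEdges G v u : ℤ)|,
    fun _ _ => abs_sub_comm _ _⟩ e

open Classical in
/-- The edge Mostar index `Mo_e(G)`: the sum of the contributions of all edges. -/
noncomputable def edgeMostar {V : Type*} [Fintype V] (G : SimpleGraph V) : ℤ :=
  ∑ e ∈ G.edgeFinset, contribution G e

/-- A bicyclic graph of size `m`: a connected graph with `m` edges, one more edge than it has
vertices. -/
def IsBicyclic {V : Type*} [Fintype V] (G : SimpleGraph V) (m : ℕ) : Prop :=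
  G.Connected ∧ G.edgeSet.ncard = Fintype.card V + 1 ∧ G.edgeSet.ncard = m

/-- The graph obtained from `H` by attaching `p` pendent vertices at the vertex `v`. -/
def attachPendants {V : Type*} (H : SimpleGraph V) (v : V) (p : ℕ) : SimpleGraph (V ⊕ Fin p) where
  Adj x y := match x, y with
    | .inl a, .inl b => H.Adj a b
    | .inl a, .inr _ => a = v
    | .inr _, .inl b => b = v
    | .inr _, .inr _ => False
  symm := ⟨by
    rintro (a | i) (b | j) h
    · exact H.adj_symm h
    · exact h
    · exact h
    · exact h⟩
  loopless := ⟨by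
    rintro (a | i) h
    · exact H.loopless.irrefl a h
    · exact h⟩

/-- Two 4-cycles sharing the vertex `0`. -/
def twoSquares : SimpleGraph (Fin 7) :=
  SimpleGraph.fromEdgeSet
    {s(0, 1), s(1, 2), s(2, 3), s(3, 0), s(0, 4), s(4, 5), s(5, 6), s(6, 0)}

/-- A 4-cycle and a triangle sharing the vertex `0`. -/
def squareTriangle : SimpleGraph (Fin 6) :=
  SimpleGraph.fromEdgeSet {s(0, 1), s(1, 2), s(2, 3), s(3, 0), s(0, 4), s(4, 5), s(5, 0)}

/-- Two triangles sharing the vertex `0`. -/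
def twoTriangles : SimpleGraph (Fin 5) :=
  SimpleGraph.fromEdgeSet {s(0, 1), s(1, 2), s(2, 0), s(0, 3), s(3, 4), s(4, 0)}

/-- The graph `Θ(1,2,2)`, that is, `K₄` minus an edge; `0, 1` have degree 3, `2, 3` degree 2. -/
def diamond : SimpleGraph (Fin 4) :=
  SimpleGraph.fromEdgeSet {s(0, 1), s(0, 2), s(2, 1), s(0, 3), s(3, 1)}

/-- The graph `Θ(2,2,2) = K_{2,3}`; `0, 1` have degree 3 and `2, 3, 4` have degree 2. -/
def thetaTwo : SimpleGraph (Fin 5) :=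
  SimpleGraph.fromEdgeSet {s(0, 2), s(2, 1), s(0, 3), s(3, 1), s(0, 4), s(4, 1)}

/-- `B_m` (size `m` when `8 ≤ m`). -/
def B (m : ℕ) : SimpleGraph (Fin 7 ⊕ Fin (m - 8)) := attachPendants twoSquares 0 (m - 8)

/-- `B¹_m` (size `m` when `7 ≤ m`). -/
def B1 (m : ℕ) : SimpleGraph (Fin 6 ⊕ Fin (m - 7)) := attachPendants squareTriangle 0 (m - 7)

/-- `B²_m` (size `m` when `6 ≤ m`). -/
def B2 (m : ℕ) : SimpleGraph (Fin 5 ⊕ Fin (m - 6)) := attachPendants twoTriangles 0 (m - 6)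

/-- `B³_m` (size `m` when `5 ≤ m`): the pendent edges are at a vertex of degree 3. -/
def B3 (m : ℕ) : SimpleGraph (Fin 4 ⊕ Fin (m - 5)) := attachPendants diamond 0 (m - 5)

/-- `B⁴_m` (size `m` when `5 ≤ m`): the pendent edges are at a vertex of degree 2. -/
def B4 (m : ℕ) : SimpleGraph (Fin 4 ⊕ Fin (m - 5)) := attachPendants diamond 2 (m - 5)

/-- `B⁵_m` (size `m` when `6 ≤ m`): the pendent edges are at a vertex of degree 2. -/
def B5 (m : ℕ) : SimpleGraph (Fin 5 ⊕ Fin (m - 6)) := attachPendants thetaTwo 2 (m - 6)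

/-- `G` and `H` are isomorphic. -/
def Isom {V W : Type*} (G : SimpleGraph V) (H : SimpleGraph W) : Prop := Nonempty (G ≃g H)

/-- `H` is a bicyclic graph of size `m` with the maximum edge Mostar index among all bicyclic
graphs of size `m` (every finite graph is isomorphic to a graph on some `Fin n`). -/
def IsMaximizer {W : Type*} [Fintype W] (H : SimpleGraph W) (m : ℕ) : Prop :=
  IsBicyclic H m ∧
    ∀ (n : ℕ) (G : SimpleGraph (Fin n)), IsBicyclic G m → edgeMostar G ≤ edgeMostar H

/-- The conjecture of Liu et al.: for all sufficiently large `m`, both `B_m` and `B⁵_m` have the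
maximum edge Mostar index among bicyclic graphs of size `m`. -/
def LiuConjecture : Prop :=
  ∃ M : ℕ, ∀ m : ℕ, M ≤ m → IsMaximizer (B m) m ∧ IsMaximizer (B5 m) m

end EdgeMostar

namespace EdgeMostar

open SimpleGraph Finset

/-! ### Transmissions and the deficiency of an edge -/

section Transmission

variable {V : Type*} {G : SimpleGraph V}

/-! Edge distances to adjacent vertices differ by at most one, so the contribution of `uv` is |T(u)
- T(v)|, where T is the sum of the distances from all edges (`contribution_eq`). The edge `uv`
itself adds nothing, hence each contribution is at most m - 1. Writing the deficiency for what is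
missing from m - 1, one has Mo_e(G) = m(m - 1) - D with D the total deficiency, and the task is to
minimise D. Pendent edges have deficiency 0, so D comes from the cycles and from hanging trees that
are not single edges.

Short cycles are cheap but not free: a triangle costs at least m + 3 altogether
(`triangle_deficiency`), each edge of a 4-cycle costs at least 3 (`square_deficiency`), and an edge
on a cycle but on no triangle or 4-cycle costs at least 4 (`four_le_deficiency`). Without triangles
and 4-cycles there are seven edges on cycles, and D is at least 28 (`deficiency_of_large_girth`).

Otherwise let X be the vertex set of a triangle or, in a triangle-free graph, of a 4-cycle. If no
second short cycle or short ear occurs, four further edges cost 16 (`exists_four_far_edges`), giving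
D at least m + 19 or 28. If a triangle or 4-cycle disjoint from X occurs, the two costs add up, and
an edge leaving X makes the total strict (`add_lt_totalDeficiency`). In the remaining cases G
contains one of eight explicit bicyclic graphs, the patterns. Since G has only one edge more than
vertices, the rest of G is a forest hanging off the pattern, and the cost of the pattern edges
depends only on how many edges hang off each pattern vertex (`exists_weights`). It is then a linear
problem with absolute values, solved pattern by pattern.

The result is `IsBicyclic.outcome`: D exceeds one of 24, m + 15, 2m + 6, or equals one of them for
one of the listed graphs. Each of the three numbers is at least their minimum, which is 2m + 6 for m
at most 8, the common value 24 at m = 9, and 24 from m = 10 on. This yields the four ranges. For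
`B5` the pattern `thetaTwoPattern` already costs at least 25 once an edge hangs off it, so it loses
to `B`. -/

@[simp] lemma edgeDist_mk (G : SimpleGraph V) (a b w : V) :
    edgeDist G s(a, b) w = min (G.dist a w) (G.dist b w) := rfl

/-- Along a shortest walk to `w` the function drops by at most one per step. This is the source of
the lower bounds for distances to pendent vertices and to patterns. -/
lemma dist_le_of_lipschitz (hG : G.Connected) (φ : V → ℕ) (w : V) (h0 : φ w = 0)
    (hφ : ∀ x y, G.Adj x y → φ x ≤ φ y + 1) (x : V) : φ x ≤ G.dist x w := by
  obtain ⟨p, hp⟩ := hG.exists_walk_length_eq_dist x w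
  rw [← hp]
  clear hp
  induction p with
  | nil => simp [h0]
  | cons h p ih =>
    have := hφ _ _ h
    have := ih h0
    simp only [Walk.length_cons]
    omega

lemma dist_le_dist_add_one (hG : G.Connected) {u v : V} (h : G.Adj u v) (x : V) :
    G.dist x v ≤ G.dist x u + 1 := by
  have := hG.dist_triangle (u := x) (v := u) (w := v)
  rwa [dist_eq_one_iff_adj.2 h] at this

lemma dist_le_dist_add_one' (hG : G.Connected) {u v : V} (h : G.Adj u v) (x : V) :
    G.dist u x ≤ G.dist v x + 1 := by
  rw [G.dist_comm, G.dist_comm (u := v)]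
  exact dist_le_dist_add_one hG h.symm x

lemma edgeDist_le_add_one (hG : G.Connected) {u v : V} (h : G.Adj u v) (f : Sym2 V) :
    edgeDist G f v ≤ edgeDist G f u + 1 := by
  induction f with | _ a b
  have := dist_le_dist_add_one hG h a
  have := dist_le_dist_add_one hG h b
  simp only [edgeDist_mk]
  omega

lemma edgeDist_eq_zero (hG : G.Connected) {f : Sym2 V} {v : V} :
    edgeDist G f v = 0 ↔ v ∈ f := by
  induction f with | _ a b
  rw [edgeDist_mk, Sym2.mem_iff, Nat.min_eq_zero_iff, hG.dist_eq_zero_iff, hG.dist_eq_zero_iff,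
    eq_comm, @eq_comm _ b]

variable [Fintype V]

open Classical in
/-- The sum of the distances from all edges to the vertex `v`. -/
noncomputable def transmission (G : SimpleGraph V) (v : V) : ℤ :=
  ∑ f ∈ G.edgeFinset, (edgeDist G f v : ℤ)

open Classical in
/-- The number of edges. -/
noncomputable def edgeCount (G : SimpleGraph V) : ℤ := (G.edgeFinset.card : ℤ)

/-- The amount by which the contribution of `e` falls short of its largest possible value. -/
noncomputable def deficiency (G : SimpleGraph V) (e : Sym2 V) : ℤ :=
  edgeCount G - 1 - contribution G e

open Classical in
/-- The sum of the deficiencies of all edges. -/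
noncomputable def totalDeficiency (G : SimpleGraph V) : ℤ := ∑ e ∈ G.edgeFinset, deficiency G e

lemma edgeMostar_eq (G : SimpleGraph V) :
    edgeMostar G = edgeCount G * (edgeCount G - 1) - totalDeficiency G := by
  classical
  simp only [edgeMostar, totalDeficiency, deficiency, Finset.sum_sub_distrib, sum_const,
    nsmul_eq_mul]
  rw [edgeCount]
  ring

lemma IsBicyclic.edgeCount_eq {m : ℕ} (h : IsBicyclic G m) : edgeCount G = m := by
  classical
  rw [edgeCount, ← h.2.2, ← coe_edgeFinset, Set.ncard_coe_finset]

/-- An edge changes its distance by -1, 0 or 1 between adjacent vertices, so counting signs is the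
same as summing differences. -/
lemma contribution_eq (hG : G.Connected) {u v : V} (h : G.Adj u v) :
    contribution G s(u, v) = |transmission G u - transmission G v| := by
  classical
  have key : (closerEdges G u v : ℤ) - closerEdges G v u =
      transmission G v - transmission G u := by
    simp only [closerEdges, transmission, Finset.card_filter, Nat.cast_sum, ← Finset.sum_sub_distrib]
    refine Finset.sum_congr rfl fun f _ => ?_
    have h1 := edgeDist_le_add_one hG h f
    have h2 := edgeDist_le_add_one hG h.symm f
    split_ifs <;> push_cast <;> omega
  rw [show contribution G s(u, v) = |(closerEdges G u v : ℤ) - closerEdges G v u| from rfl, key,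
    abs_sub_comm]

/-- Edges outside `K` are estimated by the trivial bound 1, so only the edges of `K` need to be
understood. -/
lemma transmission_sub_le (hG : G.Connected) {u v : V} (h : G.Adj u v) (K : Finset (Sym2 V))
    (hK : ∀ f ∈ K, f ∈ G.edgeSet) :
    transmission G v - transmission G u ≤
      edgeCount G - K.card + ∑ f ∈ K, ((edgeDist G f v : ℤ) - edgeDist G f u) := by
  classical
  have hsub : K ⊆ G.edgeFinset := fun f hf => by simpa using hK f hf
  rw [transmission, transmission, ← Finset.sum_sub_distrib, ← Finset.sum_sdiff hsub, edgeCount,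
    ← Finset.card_sdiff_add_card_eq_card hsub]
  have : ∑ f ∈ G.edgeFinset \ K, ((edgeDist G f v : ℤ) - edgeDist G f u) ≤
      ∑ f ∈ G.edgeFinset \ K, 1 := by
    refine Finset.sum_le_sum fun f _ => ?_
    have := edgeDist_le_add_one hG h f
    omega
  rw [Finset.sum_const, nsmul_eq_mul, mul_one] at this
  push_cast
  linarith

lemma deficiency_ge (hG : G.Connected) {u v : V} (h : G.Adj u v) (K : Finset (Sym2 V)) (c : ℤ)
    (hK : ∀ f ∈ K, f ∈ G.edgeSet)
    (h1 : c + ∑ f ∈ K, ((edgeDist G f u : ℤ) - edgeDist G f v) ≤ K.card - 1)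
    (h2 : c + ∑ f ∈ K, ((edgeDist G f v : ℤ) - edgeDist G f u) ≤ K.card - 1) :
    c ≤ deficiency G s(u, v) := by
  have a1 := transmission_sub_le hG h K hK
  have a2 := transmission_sub_le hG h.symm K hK
  rw [deficiency, contribution_eq hG h]
  rcases abs_cases (transmission G u - transmission G v) with ⟨e, _⟩ | ⟨e, _⟩ <;> rw [e] <;>
    linarith

lemma deficiency_nonneg (hG : G.Connected) {e : Sym2 V} (he : e ∈ G.edgeSet) :
    0 ≤ deficiency G e := by
  induction e with | _ u v
  have huv : G.Adj u v := he
  refine deficiency_ge hG huv {s(u, v)} 0 (by simpa using he) ?_ ?_ <;>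
    simp

lemma sum_deficiency_le (hG : G.Connected) (K : Finset (Sym2 V)) (hK : ∀ f ∈ K, f ∈ G.edgeSet) :
    ∑ f ∈ K, deficiency G f ≤ totalDeficiency G := by
  classical
  refine Finset.sum_le_sum_of_subset_of_nonneg (fun f hf => by simpa using hK f hf) ?_
  intro f hf _
  exact deficiency_nonneg hG (by simpa using hf)

/-- An edge with `j` further edges strictly closer to either end has deficiency at least `2 * j`. -/
lemma deficiency_ge_of_closer (hG : G.Connected) {u v : V} (h : G.Adj u v)
    (A A' : Finset (Sym2 V)) (j : ℕ) (hA : ∀ f ∈ A, f ∈ G.edgeSet) (hA' : ∀ f ∈ A', f ∈ G.edgeSet)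
    (cA : A.card = j) (cA' : A'.card = j)
    (dA : ∀ f ∈ A, edgeDist G f u < edgeDist G f v)
    (dA' : ∀ f ∈ A', edgeDist G f v < edgeDist G f u) :
    2 * (j : ℤ) ≤ deficiency G s(u, v) := by
  classical
  have hd : ∀ f, (edgeDist G f u : ℤ) - edgeDist G f v ≤ 1 := fun f => by
    have := edgeDist_le_add_one hG h.symm f
    omega
  have hd' : ∀ f, (edgeDist G f v : ℤ) - edgeDist G f u ≤ 1 := fun f => by
    have := edgeDist_le_add_one hG h f
    omega
  have d1 : Disjoint A A' := Finset.disjoint_left.2 fun f h1 h2 => by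
    have := dA f h1
    have := dA' f h2
    omega
  have d2 : s(u, v) ∉ A ∪ A' := by
    intro hm
    rcases Finset.mem_union.1 hm with hm | hm
    · simpa using dA _ hm
    · simpa using dA' _ hm
  have s1 : ∑ f ∈ A, ((edgeDist G f u : ℤ) - edgeDist G f v) ≤ ∑ f ∈ A, (-1) :=
    Finset.sum_le_sum fun f hf => by have := dA f hf; omega
  have s2 : ∑ f ∈ A', ((edgeDist G f v : ℤ) - edgeDist G f u) ≤ ∑ f ∈ A', (-1) :=
    Finset.sum_le_sum fun f hf => by have := dA' f hf; omega
  have s3 : ∑ f ∈ A, ((edgeDist G f v : ℤ) - edgeDist G f u) ≤ ∑ f ∈ A, 1 :=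
    Finset.sum_le_sum fun f hf => hd' f
  have s4 : ∑ f ∈ A', ((edgeDist G f u : ℤ) - edgeDist G f v) ≤ ∑ f ∈ A', 1 :=
    Finset.sum_le_sum fun f hf => hd f
  simp only [Finset.sum_const, nsmul_eq_mul, cA, cA'] at s1 s2 s3 s4
  have z : ∀ w ∈ s(u, v), edgeDist G s(u, v) w = 0 := fun w hw => (edgeDist_eq_zero hG).2 hw
  rw [Sym2.forall_mem_pair] at z
  -- The edge itself contributes 0, and `A` and `A'` cancel each other in either orientation: of 2j
  -- + 1 edges nothing is left.
  refine deficiency_ge hG h (insert s(u, v) (A ∪ A')) _ ?_ ?_ ?_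
  · intro f hf
    simp only [Finset.mem_insert, Finset.mem_union] at hf
    rcases hf with rfl | hf | hf
    · exact h
    · exact hA f hf
    · exact hA' f hf
  · rw [Finset.sum_insert d2, Finset.sum_union d1, Finset.card_insert_of_notMem d2,
      Finset.card_union_of_disjoint d1, cA, cA', z.1, z.2]
    push_cast
    linarith
  · rw [Finset.sum_insert d2, Finset.sum_union d1, Finset.card_insert_of_notMem d2,
      Finset.card_union_of_disjoint d1, cA, cA', z.1, z.2]
    push_cast
    linarith

lemma two_le_deficiency (hG : G.Connected) {u v x y : V} (h : G.Adj u v) (hx : G.Adj u x)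
    (hxv : x ≠ v) (hy : G.Adj v y) (hyu : y ≠ u) : 2 ≤ deficiency G s(u, v) := by
  have := deficiency_ge_of_closer hG h {s(u, x)} {s(v, y)} 1 (by simpa using hx) (by simpa using hy)
    rfl rfl ?_ ?_
  · simpa using this
  · simp only [mem_singleton, forall_eq]
    rw [(edgeDist_eq_zero hG).2 (by simp), Nat.pos_iff_ne_zero, Ne, edgeDist_eq_zero hG]
    simp [h.ne', hxv.symm]
  · simp only [mem_singleton, forall_eq]
    rw [(edgeDist_eq_zero hG).2 (by simp), Nat.pos_iff_ne_zero, Ne, edgeDist_eq_zero hG]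
    simp [h.ne, hyu.symm]

/-- Everything reaches the leaf `v` through `u`, so every other edge is exactly one step farther
from `v`. -/
lemma deficiency_pendant (hG : G.Connected) {u v : V} (h : G.Adj u v)
    (hv : ∀ y, G.Adj v y → y = u) : deficiency G s(u, v) = 0 := by
  classical
  have hd : ∀ x, x ≠ v → G.dist x v = G.dist x u + 1 := by
    intro x hx
    refine le_antisymm (dist_le_dist_add_one hG h x) ?_
    -- This function is 1-Lipschitz because the only neighbour of `v` is `u`, where its value is 1.
    have := dist_le_of_lipschitz hG (fun x => if x = v then 0 else G.dist x u + 1) v (by simp) ?_ x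
    · simpa [hx] using this
    · intro a b hab
      by_cases ha : a = v
      · simp [ha]
      by_cases hb : b = v
      · subst hb
        have := hv a hab.symm
        subst this
        simp [ha]
      · have := dist_le_dist_add_one hG hab.symm u
        simp only [ha, hb, if_false]
        rw [G.dist_comm (u := a), G.dist_comm (u := b)]
        omega
  have hf : ∀ f ∈ G.edgeFinset.erase s(u, v), (edgeDist G f v : ℤ) - edgeDist G f u = 1 := by
    intro f hf
    induction f with | _ a b
    simp only [mem_erase, mem_edgeFinset, mem_edgeSet] at hf
    have ha : a ≠ v := by
      rintro rfl
      exact hf.1 (by rw [hv b hf.2, Sym2.eq_swap])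
    have hb : b ≠ v := by
      rintro rfl
      exact hf.1 (by rw [hv a hf.2.symm])
    simp only [edgeDist_mk, hd a ha, hd b hb]
    omega
  have hT : transmission G v - transmission G u = edgeCount G - 1 := by
    rw [transmission, transmission, ← Finset.sum_sub_distrib,
      ← Finset.add_sum_erase _ _ (show s(u, v) ∈ G.edgeFinset by simpa using h),
      Finset.sum_congr rfl hf, edgeCount, Finset.sum_const, Finset.card_erase_of_mem (by simpa using h)]
    have : 0 < G.edgeFinset.card := Finset.card_pos.2 ⟨s(u, v), by simpa using h⟩
    simp [Nat.cast_sub this]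
  have hpos : 0 ≤ edgeCount G - 1 := by
    have : 0 < G.edgeFinset.card := Finset.card_pos.2 ⟨s(u, v), by simpa using h⟩
    rw [edgeCount]
    omega
  rw [deficiency, contribution_eq hG h, abs_sub_comm, hT, abs_of_nonneg hpos, sub_self]

/-- The three triangle edges cancel in each transmission difference, which is therefore at most m -
3. Of three numbers, the absolute differences add up to twice the largest one, hence to at most 2(m
- 3), and 3(m - 1) - 2(m - 3) = m + 3. -/
lemma triangle_deficiency (hG : G.Connected) {a b c : V} (hab : G.Adj a b) (hbc : G.Adj b c)
    (hca : G.Adj c a) :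
    edgeCount G + 3 ≤ deficiency G s(a, b) + deficiency G s(b, c) + deficiency G s(c, a) := by
  classical
  have key : ∀ a b c : V, G.Adj a b → G.Adj b c → G.Adj c a →
      transmission G b - transmission G a ≤ edgeCount G - 3 := by
    intro a b c hab hbc hca
    have := transmission_sub_le hG hab {s(a, b), s(b, c), s(c, a)} (by
      simp [hab, hbc, hca])
    have e1 : s(a, b) ∉ ({s(b, c), s(c, a)} : Finset (Sym2 V)) := by
      simp [hab.ne, hca.ne', hbc.ne]
    have e2 : s(b, c) ∉ ({s(c, a)} : Finset (Sym2 V)) := by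
      simp [hab.ne', hbc.ne]
    rw [Finset.sum_insert e1, Finset.sum_insert e2, Finset.sum_singleton,
      Finset.card_insert_of_notMem e1, Finset.card_insert_of_notMem e2] at this
    simpa [hab.ne, dist_eq_one_iff_adj.2 hab, dist_eq_one_iff_adj.2 hab.symm,
      dist_eq_one_iff_adj.2 hca, dist_eq_one_iff_adj.2 hbc,
      dist_eq_one_iff_adj.2 hca.symm, dist_eq_one_iff_adj.2 hbc.symm] using this
  have := key a b c hab hbc hca
  have := key b a c hab.symm hca.symm hbc.symm
  have := key b c a hbc hca hab
  have := key c b a hbc.symm hab.symm hca.symm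
  have := key c a b hca hab hbc
  have := key a c b hca.symm hbc.symm hab.symm
  simp only [deficiency, contribution_eq hG hab, contribution_eq hG hbc, contribution_eq hG hca]
  rcases abs_cases (transmission G a - transmission G b) with ⟨e, _⟩ | ⟨e, _⟩ <;>
  rcases abs_cases (transmission G b - transmission G c) with ⟨e', _⟩ | ⟨e', _⟩ <;>
  rcases abs_cases (transmission G c - transmission G a) with ⟨e'', _⟩ | ⟨e'', _⟩ <;>
  rw [e, e', e''] <;> linarith

/-- The opposite edge is at distance 1 from both ends and the two neighbouring edges cancel, so all
four edges of the cycle are lost from the difference. -/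
lemma square_deficiency (hG : G.Connected) {a b c d : V} (hab : G.Adj a b) (hbc : G.Adj b c)
    (hcd : G.Adj c d) (hda : G.Adj d a) (hac : a ≠ c) (hbd : b ≠ d) :
    3 ≤ deficiency G s(a, b) := by
  classical
  have e1 : s(a, b) ∉ ({s(b, c), s(c, d), s(d, a)} : Finset (Sym2 V)) := by
    simp [hab.ne, hac, hbc.ne, hbd, hda.ne']
  have e2 : s(b, c) ∉ ({s(c, d), s(d, a)} : Finset (Sym2 V)) := by
    simp [hbc.ne, hbd, hab.ne']
  have e3 : s(c, d) ∉ ({s(d, a)} : Finset (Sym2 V)) := by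
    simp [hac.symm, hcd.ne]
  have f1 : edgeDist G s(c, d) a = 1 := by
    have h1 : edgeDist G s(c, d) a ≠ 0 := by
      rw [Ne, edgeDist_eq_zero hG]
      simp [hac, hda.ne']
    have h2 := dist_eq_one_iff_adj.2 hda
    rw [edgeDist_mk] at h1 ⊢
    omega
  have f2 : edgeDist G s(c, d) b = 1 := by
    have h1 : edgeDist G s(c, d) b ≠ 0 := by
      rw [Ne, edgeDist_eq_zero hG]
      simp [hbd, hbc.ne]
    have h2 := dist_eq_one_iff_adj.2 hbc.symm
    rw [edgeDist_mk] at h1 ⊢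
    omega
  have f3 : edgeDist G s(b, c) a = 1 := by
    have h1 : edgeDist G s(b, c) a ≠ 0 := by
      rw [Ne, edgeDist_eq_zero hG]
      simp [hac, hab.ne]
    have h2 := dist_eq_one_iff_adj.2 hab.symm
    rw [edgeDist_mk] at h1 ⊢
    omega
  have f4 : edgeDist G s(d, a) b = 1 := by
    have h1 : edgeDist G s(d, a) b ≠ 0 := by
      rw [Ne, edgeDist_eq_zero hG]
      simp [hbd, hab.ne']
    have h2 := dist_eq_one_iff_adj.2 hab
    rw [edgeDist_mk] at h1 ⊢
    omega
  have f5 : edgeDist G s(b, c) b = 0 := by simp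
  have f6 : edgeDist G s(d, a) a = 0 := by simp
  have f7 : edgeDist G s(a, b) a = 0 := by simp
  have f8 : edgeDist G s(a, b) b = 0 := by simp
  refine deficiency_ge hG hab {s(a, b), s(b, c), s(c, d), s(d, a)} 3
    (by simp [hab, hbc, hcd, hda]) ?_ ?_ <;>
  rw [Finset.sum_insert e1, Finset.sum_insert e2, Finset.sum_insert e3, Finset.sum_singleton,
      Finset.card_insert_of_notMem e1, Finset.card_insert_of_notMem e2,
      Finset.card_insert_of_notMem e3, Finset.card_singleton, f1, f2, f3, f4, f5, f6, f7, f8] <;>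
  norm_num

end Transmission

/-! ### Edges on cycles and their cost -/

section Cycles

variable {V : Type*} {G : SimpleGraph V}

/-- The edge `e` lies on a cycle of `G`. -/
def OnCycle (G : SimpleGraph V) (e : Sym2 V) : Prop :=
  ∃ (u : V) (c : G.Walk u u), c.IsCycle ∧ e ∈ c.edges

lemma OnCycle.mem_edgeSet {e : Sym2 V} (h : OnCycle G e) : e ∈ G.edgeSet := by
  obtain ⟨u, c, _, he⟩ := h
  exact c.edges_subset_edgeSet he

lemma OnCycle.adj {u v : V} (h : OnCycle G s(u, v)) : G.Adj u v := h.mem_edgeSet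

lemma OnCycle.symm {u v : V} (h : OnCycle G s(u, v)) : OnCycle G s(v, u) := by
  rwa [Sym2.eq_swap]

lemma OnCycle.not_isBridge {e : Sym2 V} (h : OnCycle G e) : ¬ G.IsBridge e := by
  obtain ⟨u, c, hc, he⟩ := h
  exact fun hb => (isBridge_iff_forall_cycle_notMem (c.edges_subset_edgeSet he)).1 hb c hc he

/-- Started at `v`, the cycle has two distinct neighbours of `v`, its second and its last but one
vertex; one of them is not `u`. -/
lemma OnCycle.exists_next {u v : V} (h : OnCycle G s(u, v)) :
    ∃ w, w ≠ u ∧ OnCycle G s(v, w) := by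
  classical
  obtain ⟨x, c, hc, he⟩ := h
  have hv : v ∈ c.support := c.snd_mem_support_of_mem_edges he
  have hr := hc.rotate hv
  have hn : ¬ (c.rotate v hv).Nil := hr.not_nil
  by_cases hu : (c.rotate v hv).snd = u
  · refine ⟨(c.rotate v hv).penultimate, ?_, v, c.rotate v hv, hr, ?_⟩
    · rw [← hu]
      exact hr.snd_ne_penultimate.symm
    · rw [Sym2.eq_swap]
      exact Walk.mk_penultimate_end_mem_edges hn
  · exact ⟨_, hu, v, c.rotate v hv, hr, Walk.mk_start_snd_mem_edges hn⟩

lemma onCycle_triangle {a b c : V} (hab : G.Adj a b) (hbc : G.Adj b c) (hca : G.Adj c a) :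
    OnCycle G s(a, b) := by
  refine ⟨a, .cons hab (.cons hbc (.cons hca .nil)), ?_, by simp⟩
  simp [Walk.cons_isCycle_iff, hab.ne', hbc.ne, hca.ne', hca.ne, hab.ne]

lemma onCycle_square {a b c d : V} (hab : G.Adj a b) (hbc : G.Adj b c)
    (hcd : G.Adj c d) (hda : G.Adj d a) (hac : a ≠ c) (hbd : b ≠ d) : OnCycle G s(a, b) := by
  refine ⟨a, .cons hab (.cons hbc (.cons hcd (.cons hda .nil))), ?_, by simp⟩
  simp [Walk.cons_isCycle_iff, hab.ne', hbc.ne, hcd.ne, hda.ne, hda.ne', hac, hac.symm, hbd,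
    hab.ne]

/-- Continuing along cycle edges for two steps beyond either end gives two edges closer to that end:
without triangles and 4-cycles through `uv`, the second of them is at distance at least 2 from the
other end. -/
lemma four_le_deficiency [Fintype V] (hG : G.Connected) {u v : V} (h : OnCycle G s(u, v))
    (h3 : ∀ w, G.Adj v w → ¬ G.Adj w u)
    (h4 : ∀ w z, w ≠ u → z ≠ v → G.Adj v w → G.Adj w z → ¬ G.Adj z u) :
    4 ≤ deficiency G s(u, v) := by
  classical
  have side : ∀ u v : V, OnCycle G s(u, v) → (∀ w, G.Adj v w → ¬ G.Adj w u) →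
      (∀ w z, w ≠ u → z ≠ v → G.Adj v w → G.Adj w z → ¬ G.Adj z u) →
      ∃ A : Finset (Sym2 V), (∀ f ∈ A, f ∈ G.edgeSet) ∧ A.card = 2 ∧
        ∀ f ∈ A, edgeDist G f v < edgeDist G f u := by
    intro u v h h3 h4
    obtain ⟨w, hwu, hw⟩ := h.exists_next
    obtain ⟨z, hzv, hz⟩ := hw.exists_next
    refine ⟨{s(v, w), s(w, z)}, by simp [hw.adj, hz.adj], Finset.card_pair ?_, ?_⟩
    · simp [hw.adj.ne, hzv.symm]
    · have huv := h.adj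
      have hzu : z ≠ u := by
        rintro rfl
        exact h3 w hw.adj hz.adj
      simp only [mem_insert, mem_singleton, forall_eq_or_imp, forall_eq, edgeDist_mk]
      have e1 : G.dist v u ≠ 0 := by simp [hG.dist_eq_zero_iff, huv.ne']
      have e2 : G.dist w u ≠ 0 := by simp [hG.dist_eq_zero_iff, hwu]
      have e3 : G.dist z u ≠ 0 := by simp [hG.dist_eq_zero_iff, hzu]
      have e4 : G.dist w u ≠ 1 := by simpa [dist_eq_one_iff_adj] using h3 w hw.adj
      have e5 : G.dist z u ≠ 1 := by
        simpa [dist_eq_one_iff_adj] using h4 w z hwu hzv hw.adj hz.adj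
      have e6 : G.dist w v = 1 := dist_eq_one_iff_adj.2 hw.adj.symm
      have e7 : G.dist v v = 0 := SimpleGraph.dist_self
      omega
  obtain ⟨A, a1, a2, a3⟩ := side u v h h3 h4
  obtain ⟨A', b1, b2, b3⟩ := side v u h.symm (fun w hw hwv => h3 w hwv.symm hw.symm)
    (fun w z hw hz h1 h2 h5 => h4 z w hz hw h5.symm h2.symm h1.symm)
  simpa using deficiency_ge_of_closer hG h.adj A' A 2 b1 a1 b2 a2 b3 a3

/-- Deleting a cycle edge of `Y` keeps the graph connected with as many edges as vertices, so a
cycle remains. It is too long to fit into the rest of `Y`. -/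
lemma IsBicyclic.exists_onCycle_notMem [Fintype V] {m : ℕ} (hG : IsBicyclic G m)
    (Y : Finset (Sym2 V))
    (hY : ∃ e ∈ Y, OnCycle G e) (hc : ∀ (u : V) (c : G.Walk u u), c.IsCycle → Y.card ≤ c.length) :
    ∃ e, OnCycle G e ∧ e ∉ Y := by
  classical
  obtain ⟨e, heY, he⟩ := hY
  induction e with | _ x y
  have hconn := hG.1.connected_delete_edge_of_not_isBridge he.not_isBridge
  have hnac : ¬ (G.deleteEdges {s(x, y)}).IsAcyclic := by
    intro hac
    have h1 := IsTree.card_edgeFinset ⟨hconn, hac⟩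
    have h2 : (G.deleteEdges {s(x, y)}).edgeFinset = G.edgeFinset.erase s(x, y) := by
      ext f
      simp [and_comm]
    rw [h2, Finset.card_erase_of_mem (by simpa using he.mem_edgeSet)] at h1
    have h3 := hG.2.1
    rw [← coe_edgeFinset, Set.ncard_coe_finset] at h3
    omega
  simp only [IsAcyclic, not_forall, not_not] at hnac
  obtain ⟨u, c, hcyc⟩ := hnac
  have hle : G.deleteEdges {s(x, y)} ≤ G := deleteEdges_le _
  have hcG := hcyc.mapLe hle
  have hlen := hc _ _ hcG
  have hnd : c.edges.toFinset.card = c.length := by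
    rw [List.toFinset_card_of_nodup hcyc.isTrail.edges_nodup, Walk.length_edges]
  have hns : ¬ c.edges.toFinset ⊆ Y.erase s(x, y) := by
    intro hs
    have := Finset.card_le_card hs
    rw [hnd, Finset.card_erase_of_mem heY] at this
    have : 0 < Y.card := Finset.card_pos.2 ⟨_, heY⟩
    rw [Walk.length_map] at hlen
    omega
  obtain ⟨f, hf, hfY⟩ := Finset.not_subset.1 hns
  rw [List.mem_toFinset] at hf
  have hfG := c.edges_subset_edgeSet hf
  refine ⟨f, ⟨u, _, hcG, by rwa [Walk.edges_mapLe_eq_edges]⟩, fun hY => hfY ?_⟩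
  refine Finset.mem_erase.2 ⟨?_, hY⟩
  rintro rfl
  simp at hfG

lemma four_le_length {u : V} {c : G.Walk u u} (hc : c.IsCycle)
    (h3 : ∀ a b c, G.Adj a b → G.Adj b c → ¬ G.Adj c a) : 4 ≤ c.length := by
  match c, hc with
  | .nil, hc => exact absurd rfl hc.ne_nil
  | .cons a .nil, hc => exact absurd rfl a.ne
  | .cons a (.cons b .nil), hc => simpa using hc.three_le_length
  | .cons a (.cons b (.cons d .nil)), hc => exact absurd d (h3 _ _ _ a b)
  | .cons a (.cons b (.cons d (.cons e p))), hc => simp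

lemma five_le_length {u : V} {c : G.Walk u u} (hc : c.IsCycle)
    (h3 : ∀ a b c, G.Adj a b → G.Adj b c → ¬ G.Adj c a)
    (h4 : ∀ a b c d, a ≠ c → b ≠ d → G.Adj a b → G.Adj b c → G.Adj c d → ¬ G.Adj d a) :
    5 ≤ c.length := by
  match c, hc with
  | .nil, hc => exact absurd rfl hc.ne_nil
  | .cons a .nil, hc => exact absurd rfl a.ne
  | .cons a (.cons b .nil), hc => simpa using hc.three_le_length
  | .cons a (.cons b (.cons d .nil)), hc => exact absurd d (h3 _ _ _ a b)
  | .cons (v := x) a (.cons (v := y) b (.cons (v := z) d (.cons e .nil))), hc =>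
    simp [Walk.cons_isCycle_iff] at hc
    exact absurd e (h4 _ _ _ _ (by grind) (by grind) a b d)
  | .cons a (.cons b (.cons d (.cons e (.cons f p)))), hc => simp

/-- Edges on cycles that leave `X`, when `X` has no short ears and is close to no short cycle. -/
lemma exists_four_far_edges [Fintype V] (hG : G.Connected) (X : Set V)
    (t1 : ∀ x y z, x ∉ X → y ∉ X → z ∉ X → G.Adj x y → G.Adj y z → ¬ G.Adj z x)
    (t2 : ∀ p y z, p ∈ X → y ∉ X → z ∉ X → G.Adj p y → G.Adj y z → ¬ G.Adj z p)
    (e2 : ∀ p x q, p ∈ X → q ∈ X → x ∉ X → p ≠ q → G.Adj p x → ¬ G.Adj x q)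
    (e3 : ∀ p x y q, p ∈ X → q ∈ X → x ∉ X → y ∉ X → p ≠ q → G.Adj p x → G.Adj x y → ¬ G.Adj y q)
    (s1 : ∀ x y z t, x ∉ X → y ∉ X → z ∉ X → t ∉ X → x ≠ z → y ≠ t →
      G.Adj x y → G.Adj y z → G.Adj z t → ¬ G.Adj t x)
    (s2 : ∀ p y z t, p ∈ X → y ∉ X → z ∉ X → t ∉ X → y ≠ t →
      G.Adj p y → G.Adj y z → G.Adj z t → ¬ G.Adj t p)
    (he : ∃ u v, OnCycle G s(u, v) ∧ v ∉ X) :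
    ∃ K : Finset (Sym2 V), K.card = 4 ∧ (∀ f ∈ K, f ∈ G.edgeSet) ∧
      (∀ f ∈ K, ∃ v ∈ f, v ∉ X) ∧ 16 ≤ ∑ f ∈ K, deficiency G f := by
  classical
  -- A triangle or 4-cycle through an edge with an end outside `X` meets `X` in no vertex, in one
  -- vertex, or contains an ear of length 2 or 3 of `X`; all of these are excluded.
  have hdef : ∀ u v, OnCycle G s(u, v) → v ∉ X → 4 ≤ deficiency G s(u, v) := by
    intro u v huv hv
    have hadj := huv.adj
    refine four_le_deficiency hG huv (fun w hvw hwu => ?_) (fun w z hwu hzv hvw hwz hzu => ?_)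
    · by_cases hu : u ∈ X <;> by_cases hw : w ∈ X
      · exact e2 _ _ _ hu hw hv hwu.ne' hadj hvw
      · exact t2 _ _ _ hu hv hw hadj hvw hwu
      · exact t2 _ _ _ hw hu hv hwu hadj hvw
      · exact t1 _ _ _ hu hv hw hadj hvw hwu
    · by_cases hu : u ∈ X <;> by_cases hw : w ∈ X
      · exact e2 _ _ _ hu hw hv hwu.symm hadj hvw
      · by_cases hz : z ∈ X
        · exact e3 _ _ _ _ hu hz hv hw hzu.ne' hadj hvw hwz
        · exact s2 _ _ _ _ hu hv hw hz hzv.symm hadj hvw hwz hzu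
      · by_cases hz : z ∈ X
        · exact e3 _ _ _ _ hz hw hu hv hwz.ne' hzu hadj hvw
        · exact s2 _ _ _ _ hw hz hu hv hzv hwz hzu hadj hvw
      · by_cases hz : z ∈ X
        · exact s2 _ _ _ _ hz hu hv hw hwu.symm hzu hadj hvw hwz
        · exact s1 _ _ _ _ hu hv hw hz hwu.symm hzv.symm hadj hvw hwz hzu
  suffices hs : ∃ K : Finset (Sym2 V), K.card = 4 ∧
      ∀ f ∈ K, ∃ u v, f = s(u, v) ∧ OnCycle G s(u, v) ∧ v ∉ X by
    obtain ⟨K, h1, h2⟩ := hs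
    refine ⟨K, h1, fun f hf => ?_, fun f hf => ?_, ?_⟩
    · obtain ⟨u, v, rfl, h, _⟩ := h2 f hf
      exact h.mem_edgeSet
    · obtain ⟨u, v, rfl, _, h⟩ := h2 f hf
      exact ⟨v, by simp, h⟩
    · have := Finset.card_nsmul_le_sum K (deficiency G) 4 fun f hf => by
        obtain ⟨u, v, rfl, h, h'⟩ := h2 f hf
        exact hdef u v h h'
      rw [h1] at this
      simpa using this
  -- Four consecutive edges, each with an end among `v`, `w`, `z`. The outer vertices `u` and `y`
  -- may lie in `X`.
  have build : ∀ u v w z y, OnCycle G s(u, v) → OnCycle G s(v, w) → OnCycle G s(w, z) →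
      OnCycle G s(z, y) → w ≠ u → z ≠ v → y ≠ w → z ≠ u → v ∉ X → w ∉ X → z ∉ X →
      ∃ K : Finset (Sym2 V), K.card = 4 ∧
        ∀ f ∈ K, ∃ u v, f = s(u, v) ∧ OnCycle G s(u, v) ∧ v ∉ X := by
    intro u v w z y huv hvw hwz hzy hwu hzv hyw hzu hv hw hz
    refine ⟨{s(u, v), s(v, w), s(w, z), s(z, y)}, ?_, ?_⟩
    · rw [Finset.card_insert_of_notMem, Finset.card_insert_of_notMem, Finset.card_pair]
      · simp [hwz.adj.ne, hyw.symm]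
      · simp [hvw.adj.ne, hzv.symm, hwz.adj.ne]
      · simp [huv.adj.ne, hwu.symm, hzv.symm, hzu.symm]
    · simp only [mem_insert, mem_singleton, forall_eq_or_imp, forall_eq]
      exact ⟨⟨_, _, rfl, huv, hv⟩, ⟨_, _, rfl, hvw, hw⟩, ⟨_, _, rfl, hwz, hz⟩,
        ⟨_, _, Sym2.eq_swap, hzy.symm, hz⟩⟩
  -- If a cycle edge leaves `X`, the missing short ears keep the next two vertices outside `X`. If
  -- none does, a sequence of cycle edges that is outside `X` stays outside.
  by_cases hin : ∃ u v, OnCycle G s(u, v) ∧ u ∈ X ∧ v ∉ X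
  · obtain ⟨u, v, huv, hu, hv⟩ := hin
    obtain ⟨w, hwu, hvw⟩ := huv.exists_next
    have hw : w ∉ X := fun hw => e2 _ _ _ hu hw hv hwu.symm huv.adj hvw.adj
    obtain ⟨z, hzv, hwz⟩ := hvw.exists_next
    have hzu : z ≠ u := fun h => t2 _ _ _ hu hv hw huv.adj hvw.adj (h ▸ hwz.adj)
    have hz : z ∉ X := fun hz => e3 _ _ _ _ hu hz hv hw hzu.symm huv.adj hvw.adj hwz.adj
    obtain ⟨y, hyw, hzy⟩ := hwz.exists_next
    exact build u v w z y huv hvw hwz hzy hwu hzv hyw hzu hv hw hz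
  · push Not at hin
    obtain ⟨u, v, huv, hv⟩ := he
    have hu : u ∉ X := fun hu => hv (hin u v huv hu)
    have hout : ∀ {a b}, OnCycle G s(a, b) → a ∉ X → b ∉ X :=
      fun {a b} h ha hb => ha (hin _ _ h.symm hb)
    obtain ⟨w, hwu, hvw⟩ := huv.exists_next
    have hw := hout hvw hv
    obtain ⟨z, hzv, hwz⟩ := hvw.exists_next
    have hzu : z ≠ u := fun h => t1 _ _ _ hu hv hw huv.adj hvw.adj (h ▸ hwz.adj)
    obtain ⟨y, hyw, hzy⟩ := hwz.exists_next
    exact build u v w z y huv hvw hwz hzy hwu hzv hyw hzu hv hw (hout hwz hw)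

/-- Between two disjoint vertex sets without vertices of degree one there is an edge of positive
deficiency. -/
lemma exists_joining_edge [Fintype V] (hG : G.Connected) (X Y : Set V) (hXY : Disjoint X Y)
    (hX : X.Nonempty) (hY : Y.Nonempty)
    (dX : ∀ x ∈ X, ∃ a ∈ X, ∃ b ∈ X, a ≠ b ∧ G.Adj x a ∧ G.Adj x b)
    (dY : ∀ y ∈ Y, ∃ a b, a ≠ b ∧ G.Adj y a ∧ G.Adj y b) :
    ∃ e ∈ G.edgeSet, 0 < deficiency G e ∧ (∃ v ∈ e, v ∉ X) ∧ (∃ v ∈ e, v ∉ Y) := by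
  obtain ⟨x₀, hx₀⟩ := hX
  obtain ⟨y₀, hy₀⟩ := hY
  -- The leaves attached to `X` are added so that the edge through which a walk towards `Y` leaves
  -- `S` starts in `X` and does not end in a leaf; both its ends then have a further neighbour.
  let S : Set V := X ∪ {v | ∃ x ∈ X, ∀ y, G.Adj v y → y = x}
  have hyS : y₀ ∉ S := by
    rintro (h | ⟨x, hx, h⟩)
    · exact Set.disjoint_left.1 hXY h hy₀
    · obtain ⟨a, b, hab, ha, hb⟩ := dY y₀ hy₀
      exact hab ((h a ha).trans (h b hb).symm)
  obtain ⟨p⟩ := hG.preconnected x₀ y₀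
  obtain ⟨d, -, hd1, hd2⟩ := p.exists_boundary_dart S (Or.inl hx₀) hyS
  obtain ⟨⟨x, y⟩, hxy⟩ := d
  simp only at hd1 hd2 hxy
  have hx : x ∈ X := by
    rcases hd1 with h | ⟨x', hx', h⟩
    · exact h
    · exact absurd (Or.inl (h y hxy ▸ hx')) hd2
  have hy : y ∉ X := fun h => hd2 (Or.inl h)
  have hy2 : ∃ z, G.Adj y z ∧ z ≠ x := by
    by_contra! hcon
    exact hd2 (Or.inr ⟨x, hx, hcon⟩)
  obtain ⟨z, hz, hzx⟩ := hy2
  obtain ⟨a, haX, -, -, -, ha, -⟩ := dX x hx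
  refine ⟨s(x, y), hxy, ?_, ⟨y, by simp, hy⟩, ⟨x, by simp, Set.disjoint_left.1 hXY hx⟩⟩
  have := two_le_deficiency hG hxy ha (fun h => hy (h ▸ haX)) hz hzx
  omega

/-- Any chord of a 5-cycle cuts off a triangle. -/
lemma chord_of_five_cycle {u : V} {c : G.Walk u u} (hl : c.length = 5)
    (h3 : ∀ a b c, G.Adj a b → G.Adj b c → ¬ G.Adj c a) {x y : V} (hx : x ∈ c.support)
    (hy : y ∈ c.support) (hxy : G.Adj x y) : s(x, y) ∈ c.edges := by
  match c, hl with
  | .cons (v := a) h1 (.cons (v := b) h2 (.cons (v := d) h3' (.cons (v := e) h4 (.cons h5 .nil)))), _ =>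
    simp only [Walk.support_cons, Walk.support_nil, List.mem_cons, List.not_mem_nil, or_false] at hx hy
    simp only [Walk.edges_cons, Walk.edges_nil, List.mem_cons, List.not_mem_nil, or_false]
    have k1 := h3 _ _ _ h1 h2
    have k2 := h3 _ _ _ h2 h3'
    have k3 := h3 _ _ _ h3' h4
    have k4 := h3 _ _ _ h4 h5
    have k5 := h3 _ _ _ h5 h1
    have hne := hxy.ne
    have hs := hxy.symm
    rcases hx with rfl | rfl | rfl | rfl | rfl | rfl <;>
    rcases hy with rfl | rfl | rfl | rfl | rfl | rfl <;>
    first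
    | exact absurd rfl hne
    | exact absurd hxy ‹_›
    | exact absurd hs ‹_›
    | simp

lemma IsBicyclic.exists_isCycle_le [Fintype V] {m : ℕ} (hG : IsBicyclic G m) :
    ∃ (u : V) (c : G.Walk u u), c.IsCycle ∧
      ∀ (v : V) (c' : G.Walk v v), c'.IsCycle → c.length ≤ c'.length := by
  classical
  have hnac : ¬ G.IsAcyclic := by
    intro hac
    have h1 := IsTree.card_edgeFinset ⟨hG.1, hac⟩
    have h3 := hG.2.1
    rw [← coe_edgeFinset, Set.ncard_coe_finset] at h3
    omega
  obtain ⟨u, c, hc, hl⟩ := exists_girth_eq_length.2 hnac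
  exact ⟨u, c, hc, fun v c' hc' => hl ▸ girth_le_length hc'⟩

/-- Seven edges on cycles suffice, at cost 4 each. A shortest cycle of length at least 6 needs one
further cycle edge. For length 5 the further edge is not a chord, so it has an end off the cycle,
and continuing there gives a second one. -/
lemma IsBicyclic.deficiency_of_large_girth [Fintype V] {m : ℕ} (hG : IsBicyclic G m)
    (h3 : ∀ a b c, G.Adj a b → G.Adj b c → ¬ G.Adj c a)
    (h4 : ∀ a b c d, a ≠ c → b ≠ d → G.Adj a b → G.Adj b c → G.Adj c d → ¬ G.Adj d a) :
    28 ≤ totalDeficiency G := by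
  classical
  suffices h : ∃ K : Finset (Sym2 V), 7 ≤ K.card ∧ ∀ f ∈ K, OnCycle G f by
    obtain ⟨K, hK, hon⟩ := h
    have h1 := Finset.card_nsmul_le_sum K (deficiency G) 4 fun f hf => by
      induction f with | _ u v
      refine four_le_deficiency hG.1 (hon _ hf) (fun w hvw hwu => ?_)
        (fun w z hwu hzv hvw hwz hzu => ?_)
      · exact h3 _ _ _ (hon _ hf).adj hvw hwu
      · exact h4 _ _ _ _ hwu.symm hzv.symm (hon _ hf).adj hvw hwz hzu
    have h2 := sum_deficiency_le hG.1 K fun f hf => (hon f hf).mem_edgeSet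
    rw [nsmul_eq_mul] at h1
    have : (7 : ℤ) ≤ K.card := by exact_mod_cast hK
    linarith
  obtain ⟨u, c, hc, hmin⟩ := hG.exists_isCycle_le
  have hY : c.edges.toFinset.card = c.length := by
    rw [List.toFinset_card_of_nodup hc.isTrail.edges_nodup, Walk.length_edges]
  have hon : ∀ f ∈ c.edges.toFinset, OnCycle G f := fun f hf =>
    ⟨u, c, hc, List.mem_toFinset.1 hf⟩
  have hlen := five_le_length hc h3 h4
  have hne : c.edges.toFinset.Nonempty := Finset.card_pos.1 (by omega)
  obtain ⟨e, he, heY⟩ := hG.exists_onCycle_notMem c.edges.toFinset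
    (hne.imp fun f hf => ⟨hf, hon f hf⟩) (fun v c' hc' => hY ▸ hmin v c' hc')
  by_cases hl : c.length = 5
  · have main : ∀ x y, s(x, y) = e → x ∉ c.support →
        ∃ K : Finset (Sym2 V), 7 ≤ K.card ∧ ∀ f ∈ K, OnCycle G f := by
      rintro x y rfl hx
      obtain ⟨w, hw, hxw⟩ := he.symm.exists_next
      have hxwY : s(x, w) ∉ c.edges.toFinset := fun h =>
        hx (c.fst_mem_support_of_mem_edges (List.mem_toFinset.1 h))
      refine ⟨insert s(x, w) (insert s(x, y) c.edges.toFinset), ?_, ?_⟩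
      · rw [Finset.card_insert_of_notMem, Finset.card_insert_of_notMem heY, hY, hl]
        simp only [mem_insert, not_or]
        exact ⟨by simp [hw, he.adj.ne], hxwY⟩
      · intro f hf
        simp only [mem_insert] at hf
        rcases hf with rfl | rfl | hf
        · exact hxw
        · exact he
        · exact hon f hf
    induction e with | _ x y
    by_cases hx : x ∈ c.support
    · by_cases hy : y ∈ c.support
      · exact absurd (List.mem_toFinset.2 (chord_of_five_cycle hl h3 hx hy he.adj)) heY
      · exact main y x Sym2.eq_swap hy
    · exact main x y rfl hx
  · refine ⟨insert e c.edges.toFinset, ?_, ?_⟩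
    · rw [Finset.card_insert_of_notMem heY, hY]
      omega
    · intro f hf
      rcases Finset.mem_insert.1 hf with rfl | hf
      · exact he
      · exact hon f hf

end Cycles

/-! ### Patterns and the forest hanging off them -/

/-- A connected graph on `Fin k` with `k + 1` listed edges and minimum degree at least two, together
with its distance function. -/
structure BicyclicPattern (k : ℕ) where
  /-- the list of edges -/
  edge : Fin (k + 1) → Fin k × Fin k
  /-- the distance -/
  d : Fin k → Fin k → ℕ
  edge_inj : Function.Injective fun t => s((edge t).1, (edge t).2)
  d_self : ∀ i, d i i = 0
  -- Together with `d_self`, this bounds `d` from above by the graph distance; `d_step` provides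
  -- descending paths and hence the reverse bound.
  d_lip : ∀ t j, d (edge t).1 j ≤ d (edge t).2 j + 1 ∧ d (edge t).2 j ≤ d (edge t).1 j + 1
  d_step : ∀ i j, i = j ∨ ∃ t, ((edge t).1 = i ∧ d (edge t).2 j + 1 = d i j) ∨
    ((edge t).2 = i ∧ d (edge t).1 j + 1 = d i j)
  two_nbrs : ∀ i, ∃ a b, a ≠ b ∧ (∃ t, s((edge t).1, (edge t).2) = s(i, a)) ∧
    ∃ t, s((edge t).1, (edge t).2) = s(i, b)

namespace BicyclicPattern

variable {k : ℕ} (P : BicyclicPattern k)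

/-- The difference of the transmissions of the ends of an edge, if `w l` further edges hang off
the vertex `l`. -/
def gap (w : Fin k → ℕ) (t : Fin (k + 1)) : ℤ :=
  ∑ s, ((min (P.d (P.edge s).1 (P.edge t).1) (P.d (P.edge s).2 (P.edge t).1) : ℕ) -
    (min (P.d (P.edge s).1 (P.edge t).2) (P.d (P.edge s).2 (P.edge t).2) : ℕ) : ℤ) +
  ∑ l, ((P.d l (P.edge t).1 : ℤ) - P.d l (P.edge t).2) * w l

/-- The total deficiency of the edges of the pattern, if `w l` further edges hang off the
vertex `l`. -/
def defect (w : Fin k → ℕ) : ℤ := ∑ t, ((k + ∑ l, w l : ℕ) - |P.gap w t| : ℤ)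

variable {V : Type*} {G : SimpleGraph V} {m : ℕ} {ι : Fin k → V}

/-- The height is the distance to the pattern, and the parent is the next vertex on a shortest walk
to it. -/
lemma exists_height [Nonempty (Fin k)] (hG : G.Connected) (ι : Fin k → V) :
    ∃ (h : V → ℕ) (par : V → V), (∀ i, h (ι i) = 0) ∧ (∀ x, h x = 0 → x ∈ Set.range ι) ∧
      (∀ x y, G.Adj x y → h x ≤ h y + 1) ∧
      ∀ x, x ∉ Set.range ι → G.Adj x (par x) ∧ h x = h (par x) + 1 := by
  classical
  let h : V → ℕ := fun x => ⨅ i, G.dist x (ι i)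
  have hle : ∀ x i, h x ≤ G.dist x (ι i) := fun x i => ciInf_le (OrderBot.bddBelow _) i
  have hex : ∀ x, ∃ i, G.dist x (ι i) = h x := fun x => ciInf_mem fun i => G.dist x (ι i)
  have hlip : ∀ x y, G.Adj x y → h x ≤ h y + 1 := by
    intro x y hxy
    obtain ⟨i, hi⟩ := hex y
    have := dist_le_dist_add_one' hG hxy (ι i)
    have := hle x i
    omega
  have h0 : ∀ i, h (ι i) = 0 := fun i => by simpa using hle (ι i) i
  have hpar : ∀ x, ∃ y, x ∉ Set.range ι → G.Adj x y ∧ h x = h y + 1 := by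
    intro x
    by_cases hx : x ∈ Set.range ι
    · exact ⟨x, fun h => absurd hx h⟩
    obtain ⟨i, hi⟩ := hex x
    obtain ⟨p, hp⟩ := hG.exists_walk_length_eq_dist x (ι i)
    cases p with
    | nil => exact absurd ⟨i, rfl⟩ hx
    | @cons _ y _ hxy p =>
      refine ⟨y, fun _ => ⟨hxy, ?_⟩⟩
      have h1 := hlip x y hxy
      have h2 := hle y i
      have h3 := G.dist_le p
      simp only [Walk.length_cons] at hp
      omega
  choose par hpar using hpar
  refine ⟨h, par, h0, fun x hx => ?_, hlip, hpar⟩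
  obtain ⟨i, hi⟩ := hex x
  exact ⟨i, ((hG.dist_eq_zero_iff).1 (hi.trans hx)).symm⟩

open Classical in
/-- The edges of the copy of the pattern. -/
noncomputable def edges (ι : Fin k → V) : Finset (Sym2 V) :=
  univ.image fun t => s(ι (P.edge t).1, ι (P.edge t).2)

lemma edges_inj (hι : Function.Injective ι) :
    Function.Injective fun t => s(ι (P.edge t).1, ι (P.edge t).2) := by
  intro s t h
  exact P.edge_inj (Sym2.map.injective hι (by simpa using h))

open Classical in
lemma card_edges (hι : Function.Injective ι) : (P.edges ι).card = k + 1 := by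
  rw [edges, Finset.card_image_of_injective _ (P.edges_inj hι), Finset.card_univ, Fintype.card_fin]

open Classical in
lemma sum_edges (hι : Function.Injective ι) {M : Type*} [AddCommMonoid M] (f : Sym2 V → M) :
    ∑ e ∈ P.edges ι, f e = ∑ t, f s(ι (P.edge t).1, ι (P.edge t).2) :=
  Finset.sum_image fun _ _ _ _ h => P.edges_inj hι h

/-- Each vertex outside the pattern owns the edge to its parent. With the k + 1 pattern edges this
makes |V| + 1 edges, so there are no others: the rest is a forest, `ρ` sends a vertex to the root of
its tree, and every path into the pattern passes through that root. -/
lemma exists_retraction [Fintype V] (hG : IsBicyclic G m) (hι : Function.Injective ι)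
    (hadj : ∀ t, G.Adj (ι (P.edge t).1) (ι (P.edge t).2)) :
    ∃ (h : V → ℕ) (par : V → V) (ρ : V → Fin k), (∀ i, h (ι i) = 0) ∧ (∀ i, ρ (ι i) = i) ∧
      (∀ x, x ∉ Set.range ι → G.Adj x (par x) ∧ h x = h (par x) + 1 ∧ ρ (par x) = ρ x) ∧
      (∀ e ∈ G.edgeSet, e ∈ P.edges ι ∨ ∃ x, x ∉ Set.range ι ∧ e = s(x, par x)) ∧
      (∀ x i, G.dist x (ι i) = h x + P.d (ρ x) i) := by
  classical
  have : Nonempty (Fin k) := ⟨(P.edge 0).1⟩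
  obtain ⟨h, par, h0, h0', hlip, hpar⟩ := exists_height hG.1 ι
  have hit : ∀ n x, h x = n → par^[n] x ∈ Set.range ι := by
    intro n
    induction n with
    | zero => exact fun x hx => h0' x hx
    | succ n ih =>
      intro x hx
      rw [Function.iterate_succ_apply]
      refine ih _ ?_
      have := (hpar x ?_).2
      · omega
      · rintro ⟨i, rfl⟩
        simp [h0] at hx
  choose ρ hρ using fun x => hit (h x) x rfl
  have hρι : ∀ i, ρ (ι i) = i := fun i => hι (by rw [hρ, h0]; rfl)
  have hρpar : ∀ x, x ∉ Set.range ι → ρ (par x) = ρ x := fun x hx => hι (by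
    rw [hρ, hρ, (hpar x hx).2, Function.iterate_succ_apply])
  let N : Finset V := univ.filter (· ∉ Set.range ι)
  have hN : N.card + k = Fintype.card V := by
    have h1 := Finset.card_filter_add_card_filter_not (s := (univ : Finset V))
      (· ∈ Set.range ι)
    have h2 : (univ.filter (· ∈ Set.range ι)).card = k := by
      have : univ.filter (· ∈ Set.range ι) = univ.image ι := by ext; simp
      rw [this, Finset.card_image_of_injective _ hι]
      simp
    rw [h2, Finset.card_univ] at h1
    rw [add_comm]
    exact h1
  -- Two vertices owning the same edge would be parents of each other, against the heights.
  have hinj : Set.InjOn (fun x => s(x, par x)) N := by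
    intro x hx y hy hxy
    simp only [N, coe_filter, mem_univ, true_and, Set.mem_ofPred_eq] at hx hy
    have h1 := (hpar x hx).2
    have h2 := (hpar y hy).2
    simp only [Sym2.eq_iff] at hxy
    rcases hxy with ⟨hh, -⟩ | ⟨hh, hh'⟩
    · exact hh
    · rw [hh'] at h1
      rw [← hh] at h2
      omega
  have hdisj : Disjoint (P.edges ι) (N.image fun x => s(x, par x)) := by
    rw [Finset.disjoint_left]
    intro e he he'
    obtain ⟨x, hx, rfl⟩ := Finset.mem_image.1 he'
    obtain ⟨t, -, ht⟩ := Finset.mem_image.1 he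
    simp only [N, mem_filter, mem_univ, true_and] at hx
    have : x ∈ s(ι (P.edge t).1, ι (P.edge t).2) := by rw [ht]; simp
    rcases Sym2.mem_iff.1 this with rfl | rfl <;> exact hx ⟨_, rfl⟩
  have hsub : P.edges ι ∪ N.image (fun x => s(x, par x)) ⊆ G.edgeFinset := by
    intro e he
    rcases Finset.mem_union.1 he with he | he
    · obtain ⟨t, -, rfl⟩ := Finset.mem_image.1 he
      simpa using hadj t
    · obtain ⟨x, hx, rfl⟩ := Finset.mem_image.1 he
      simp only [N, mem_filter, mem_univ, true_and] at hx
      simpa using (hpar x hx).1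
  have heq := Finset.eq_of_subset_of_card_le hsub (by
    rw [Finset.card_union_of_disjoint hdisj, Finset.card_image_of_injOn hinj,
      P.card_edges hι]
    have := hG.2.1
    rw [← coe_edgeFinset, Set.ncard_coe_finset] at this
    omega)
  have hclass : ∀ e ∈ G.edgeSet, e ∈ P.edges ι ∨ ∃ x, x ∉ Set.range ι ∧ e = s(x, par x) := by
    intro e he
    rw [← mem_edgeFinset, ← heq, Finset.mem_union, Finset.mem_image] at he
    refine he.imp_right ?_
    rintro ⟨x, hx, rfl⟩
    exact ⟨x, by simpa [N] using hx, rfl⟩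
  refine ⟨h, par, ρ, h0, hρι, fun x hx => ⟨(hpar x hx).1, (hpar x hx).2, hρpar x hx⟩, hclass, ?_⟩
  intro x i
  refine le_antisymm ?_ ?_
  · have hA : ∀ n x, h x = n → G.dist x (ι (ρ x)) ≤ n := by
      intro n
      induction n with
      | zero =>
        intro x hx
        obtain ⟨j, rfl⟩ := h0' x hx
        simp [hρι]
      | succ n ih =>
        intro x hx
        have hxr : x ∉ Set.range ι := by
          rintro ⟨i, rfl⟩
          simp [h0] at hx
        obtain ⟨p1, p2⟩ := hpar x hxr
        have := ih (par x) (by omega)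
        rw [hρpar x hxr] at this
        have h2 := dist_le_dist_add_one' hG.1 p1 (ι (ρ x))
        omega
    have hB : ∀ n j, P.d j i = n → G.dist (ι j) (ι i) ≤ n := by
      intro n
      induction n with
      | zero =>
        intro j hj
        rcases P.d_step j i with rfl | ⟨t, ht | ht⟩
        · simp
        · omega
        · omega
      | succ n ih =>
        intro j hj
        rcases P.d_step j i with rfl | ⟨t, ⟨rfl, ht⟩ | ⟨rfl, ht⟩⟩
        · simp
        · have h1 := ih _ (show P.d (P.edge t).2 i = n by omega)
          have h2 := dist_le_dist_add_one' hG.1 (hadj t) (ι i)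
          omega
        · have h1 := ih _ (show P.d (P.edge t).1 i = n by omega)
          have h2 := dist_le_dist_add_one' hG.1 (hadj t).symm (ι i)
          omega
    have := hA _ x rfl
    have := hB _ (ρ x) rfl
    have := hG.1.dist_triangle (u := x) (v := ι (ρ x)) (w := ι i)
    omega
  -- Since all edges are known, the claimed distance can be checked to be 1-Lipschitz edge by edge.
  · refine dist_le_of_lipschitz hG.1 (fun x => h x + P.d (ρ x) i) (ι i)
      (by simp [h0, hρι, P.d_self]) ?_ x
    intro x y hxy
    rcases hclass s(x, y) hxy with he | ⟨z, hz, he⟩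
    · obtain ⟨t, -, ht⟩ := Finset.mem_image.1 he
      have := P.d_lip t i
      rcases Sym2.eq_iff.1 ht with ⟨rfl, rfl⟩ | ⟨rfl, rfl⟩ <;> simp only [h0, hρι] <;> omega
    · have := hρpar z hz
      have := (hpar z hz).2
      rcases Sym2.eq_iff.1 he with ⟨rfl, rfl⟩ | ⟨rfl, rfl⟩ <;> simp only [*] <;> omega

/-- The weight of a pattern vertex is the number of non-pattern vertices, equivalently hanging
edges, in its tree. The total deficiency is `defect` plus the deficiencies of the hanging edges,
which are nonnegative. When all weight sits at one vertex, equality therefore means that all hanging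
edges are pendent there, and conversely. The last clause says that the copy of the pattern is
induced. -/
theorem exists_weights [Fintype V] (hG : IsBicyclic G m) (hι : Function.Injective ι)
    (hadj : ∀ t, G.Adj (ι (P.edge t).1) (ι (P.edge t).2)) :
    ∃ w : Fin k → ℕ, m = k + 1 + ∑ l, w l ∧
      P.defect w ≤ totalDeficiency G ∧
      (∀ l₀, (∀ l, l ≠ l₀ → w l = 0) →
        totalDeficiency G = P.defect w →
        ∀ x, x ∉ Set.range ι → ∀ y, G.Adj x y ↔ y = ι l₀) ∧
      (∀ l₀, (∀ x, x ∉ Set.range ι → ∀ y, G.Adj x y ↔ y = ι l₀) →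
        (∀ l, l ≠ l₀ → w l = 0) ∧ totalDeficiency G = P.defect w) ∧
      (∀ i j, G.Adj (ι i) (ι j) → ∃ t, s((P.edge t).1, (P.edge t).2) = s(i, j)) := by
  classical
  obtain ⟨h, par, ρ, h0, hρι, hpar, hclass, hdist⟩ := P.exists_retraction hG hι hadj
  let N : Finset V := univ.filter (· ∉ Set.range ι)
  have hmN : ∀ {x}, x ∈ N ↔ x ∉ Set.range ι := by simp [N]
  have hinj : Set.InjOn (fun x => s(x, par x)) N := by
    intro x hx y hy hxy
    have h1 := (hpar x (hmN.1 hx)).2.1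
    have h2 := (hpar y (hmN.1 hy)).2.1
    simp only [Sym2.eq_iff] at hxy
    rcases hxy with ⟨hh, -⟩ | ⟨hh, hh'⟩
    · exact hh
    · rw [hh'] at h1
      rw [← hh] at h2
      omega
  have hdisj : Disjoint (P.edges ι) (N.image fun x => s(x, par x)) := by
    rw [Finset.disjoint_left]
    intro e he he'
    obtain ⟨x, hx, rfl⟩ := Finset.mem_image.1 he'
    obtain ⟨t, -, ht⟩ := Finset.mem_image.1 he
    rw [hmN] at hx
    have : x ∈ s(ι (P.edge t).1, ι (P.edge t).2) := by rw [ht]; simp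
    rcases Sym2.mem_iff.1 this with rfl | rfl <;> exact hx ⟨_, rfl⟩
  have hE : G.edgeFinset = P.edges ι ∪ N.image (fun x => s(x, par x)) := by
    ext e
    rw [mem_edgeFinset, Finset.mem_union, Finset.mem_image]
    constructor
    · intro he
      refine (hclass e he).imp_right ?_
      rintro ⟨x, hx, rfl⟩
      exact ⟨x, hmN.2 hx, rfl⟩
    · rintro (he | ⟨x, hx, rfl⟩)
      · obtain ⟨t, -, rfl⟩ := Finset.mem_image.1 he
        exact hadj t
      · exact (hpar x (hmN.1 hx)).1
  have hsum : ∀ f : Sym2 V → ℤ, ∑ e ∈ G.edgeFinset, f e =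
      ∑ t, f s(ι (P.edge t).1, ι (P.edge t).2) + ∑ x ∈ N, f s(x, par x) := by
    intro f
    rw [hE, Finset.sum_union hdisj, P.sum_edges hι, Finset.sum_image hinj]
  have hmcount : (m : ℤ) = k + 1 + N.card := by
    have := hsum fun _ => 1
    rw [← hG.edgeCount_eq, edgeCount]
    simpa using this
  let w : Fin k → ℕ := fun l => (N.filter (ρ · = l)).card
  have hw : ∀ g : Fin k → ℤ, ∑ x ∈ N, g (ρ x) = ∑ l, g l * w l := by
    intro g
    rw [← Finset.sum_fiberwise N ρ]
    refine Finset.sum_congr rfl fun l _ => ?_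
    rw [Finset.sum_congr rfl (g := fun _ => g l) (by simp +contextual), Finset.sum_const,
      nsmul_eq_mul, mul_comm]
  -- A hanging edge is at the distance of its parent end. The sum of the heights does not depend on
  -- `i` and cancels in differences.
  have hT : ∀ i, transmission G (ι i) = ∑ s, ((min (P.d (P.edge s).1 i) (P.d (P.edge s).2 i) : ℕ) : ℤ)
      + (∑ x ∈ N, (h (par x) : ℤ) + ∑ l, (P.d l i : ℤ) * w l) := by
    intro i
    rw [transmission, hsum, ← hw fun l => (P.d l i : ℤ), ← Finset.sum_add_distrib]
    congr 1
    · simp only [edgeDist_mk, hdist, h0, hρι, zero_add]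
    · refine Finset.sum_congr rfl fun x hx => ?_
      obtain ⟨-, h1, h2⟩ := hpar x (hmN.1 hx)
      simp only [edgeDist_mk, hdist, h1, h2]
      push_cast
      omega
  have hdef : ∀ t, deficiency G s(ι (P.edge t).1, ι (P.edge t).2) = (m : ℤ) - 1 - |P.gap w t| := by
    intro t
    rw [deficiency, contribution_eq hG.1 (hadj t), hG.edgeCount_eq, hT, hT, gap]
    congr 2
    simp only [sub_mul, Finset.sum_sub_distrib]
    ring
  have hwN : (N.card : ℤ) = ∑ l, (w l : ℤ) := by simpa using hw fun _ => 1
  have hD : totalDeficiency G = P.defect w + ∑ x ∈ N, deficiency G s(x, par x) := by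
    rw [totalDeficiency, hsum, defect]
    congr 1
    refine Finset.sum_congr rfl fun t _ => ?_
    rw [hdef, hmcount, hwN]
    push_cast
    ring
  have hnn : ∀ x ∈ N, 0 ≤ deficiency G s(x, par x) := fun x hx =>
    deficiency_nonneg hG.1 (hpar x (hmN.1 hx)).1
  have hedge : ∀ {x y}, x ∉ Set.range ι → G.Adj x y → y = par x ∨ (y ∉ Set.range ι ∧ x = par y) := by
    intro x y hx hxy
    rcases hclass s(x, y) hxy with he | ⟨z, hz, he⟩
    · obtain ⟨t, -, ht⟩ := Finset.mem_image.1 he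
      rcases Sym2.eq_iff.1 ht with ⟨rfl, rfl⟩ | ⟨rfl, rfl⟩ <;> exact absurd ⟨_, rfl⟩ hx
    · rcases Sym2.eq_iff.1 he with ⟨rfl, rfl⟩ | ⟨rfl, rfl⟩
      · exact Or.inl rfl
      · exact Or.inr ⟨hz, rfl⟩
  refine ⟨w, ?_, ?_, ?_, ?_, ?_⟩
  · rw [hwN] at hmcount
    exact_mod_cast hmcount
  · rw [hD]
    linarith [Finset.sum_nonneg hnn]
  · intro l₀ hl₀ heq
    have hz : ∀ x ∈ N, deficiency G s(x, par x) = 0 := by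
      refine (Finset.sum_eq_zero_iff_of_nonneg hnn).1 ?_
      linarith
    have hρ₀ : ∀ x, x ∉ Set.range ι → ρ x = l₀ := by
      intro x hx
      by_contra hne
      have := hl₀ _ hne
      simp only [w, Finset.card_eq_zero, Finset.filter_eq_empty_iff] at this
      exact this (hmN.2 hx) rfl
    have hpar₀ : ∀ x, x ∉ Set.range ι → par x ∈ Set.range ι := by
      intro x hx
      -- A vertex of height at least 2 would give its parent a second neighbour, and the edge from
      -- the parent downwards to the pattern would have deficiency at least 2.
      by_contra hp
      obtain ⟨a1, a2, -⟩ := hpar x hx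
      obtain ⟨b1, b2, -⟩ := hpar _ hp
      have hxz : ∃ z, G.Adj (par (par x)) z ∧ z ≠ par x := by
        by_cases hpp : par (par x) ∈ Set.range ι
        · obtain ⟨i, hi⟩ := hpp
          obtain ⟨a, -, -, ⟨t, ht⟩, -⟩ := P.two_nbrs i
          refine ⟨ι a, ?_, fun h => hp ⟨a, h⟩⟩
          have := hadj t
          rw [← hi]
          rcases Sym2.eq_iff.1 ht with ⟨h1, h2⟩ | ⟨h1, h2⟩ <;> rw [h1, h2] at this
          · exact this
          · exact this.symm
        · obtain ⟨c1, c2, -⟩ := hpar _ hpp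
          exact ⟨_, c1, fun h => by rw [h] at c2; omega⟩
      obtain ⟨z, hz1, hz2⟩ := hxz
      have h1 := two_le_deficiency hG.1 b1 a1.symm (fun h => by rw [← h] at b2; omega) hz1 hz2
      have h2 := hz _ (hmN.2 hp)
      omega
    have hparι : ∀ x, x ∉ Set.range ι → par x = ι l₀ := by
      intro x hx
      obtain ⟨i, hi⟩ := hpar₀ x hx
      have h1 := (hpar x hx).2.2
      rw [hρ₀ x hx, ← hi, hρι] at h1
      rw [← hi, h1]
    intro x hx y
    constructor
    · intro hxy
      rcases hedge hx hxy with rfl | ⟨hy, rfl⟩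
      · exact hparι x hx
      · exact absurd (hpar₀ y hy) hx
    · rintro rfl
      rw [← hparι x hx]
      exact (hpar x hx).1
  · intro l₀ hl₀
    have hparι : ∀ x, x ∉ Set.range ι → par x = ι l₀ := fun x hx =>
      (hl₀ x hx _).1 (hpar x hx).1
    refine ⟨?_, ?_⟩
    · intro l hl
      simp only [w, Finset.card_eq_zero, Finset.filter_eq_empty_iff]
      rintro x hx rfl
      obtain ⟨-, -, h3⟩ := hpar x (hmN.1 hx)
      rw [hparι x (hmN.1 hx), hρι] at h3
      exact hl h3.symm
    · rw [hD, add_eq_left]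
      refine Finset.sum_eq_zero ?_
      intro x hx
      rw [Sym2.eq_swap]
      refine deficiency_pendant hG.1 (hpar x (hmN.1 hx)).1.symm fun y hy => ?_
      rw [hparι x (hmN.1 hx)]
      exact (hl₀ x (hmN.1 hx) y).1 hy
  · intro i j hij
    rcases hclass s(ι i, ι j) hij with he | ⟨z, hz, he⟩
    · obtain ⟨t, -, ht⟩ := Finset.mem_image.1 he
      exact ⟨t, Sym2.map.injective hι (by simpa using ht)⟩
    · rcases Sym2.eq_iff.1 he with ⟨rfl, -⟩ | ⟨-, rfl⟩ <;> exact absurd ⟨_, rfl⟩ hz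

end BicyclicPattern

/-! ### Recognising graphs with all pendent edges at one vertex -/

section Pendants

variable {k p : ℕ} {V : Type*} {G : SimpleGraph V} {H : SimpleGraph (Fin k)} {l₀ : Fin k}

lemma isom_attachPendants [Fintype V] (ι : Fin k → V) (hι : Function.Injective ι)
    (hV : Fintype.card V = k + p) (hH : ∀ i j, G.Adj (ι i) (ι j) ↔ H.Adj i j)
    (hpend : ∀ x, x ∉ Set.range ι → ∀ y, G.Adj x y ↔ y = ι l₀) :
    Isom G (attachPendants H l₀ p) := by
  classical
  let e₁ : Fin k ≃ Set.range ι := Equiv.ofInjective ι hι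
  have hc : Fintype.card {x // x ∉ Set.range ι} = p := by
    rw [Fintype.card_subtype_compl, Fintype.card_congr e₁.symm, Fintype.card_fin, hV]
    omega
  let e₂ : Fin p ≃ {x // x ∉ Set.range ι} := (Fintype.equivFinOfCardEq hc).symm
  let e : Fin k ⊕ Fin p ≃ V := (Equiv.sumCongr e₁ e₂).trans (Equiv.sumCompl (· ∈ Set.range ι))
  have hl : ∀ i, e (.inl i) = ι i := fun i => by simp [e, e₁]
  have hr : ∀ i, e (.inr i) ∉ Set.range ι := fun i => by
    simpa [e] using (e₂ i).2
  refine ⟨SimpleGraph.Iso.symm ⟨e, ?_⟩⟩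
  rintro (i | i) (j | j)
  · rw [hl, hl]
    exact hH i j
  · rw [hl, G.adj_comm, hpend _ (hr j), hι.eq_iff]
    rfl
  · rw [hl, hpend _ (hr i), hι.eq_iff]
    rfl
  · rw [hpend _ (hr i)]
    refine iff_of_false (fun h => hr j ⟨_, h.symm⟩) ?_
    exact fun h => h

lemma exists_embedding_of_isom (h : Isom G (attachPendants H l₀ p)) :
    ∃ ι : Fin k → V, Function.Injective ι ∧ (∀ i j, G.Adj (ι i) (ι j) ↔ H.Adj i j) ∧
      ∀ x, x ∉ Set.range ι → ∀ y, G.Adj x y ↔ y = ι l₀ := by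
  obtain ⟨e⟩ := h
  refine ⟨fun i => e.symm (.inl i), fun i j hij => by simpa using hij, fun i j => ?_, ?_⟩
  · rw [e.symm.map_adj_iff]
    rfl
  · intro x hx y
    rw [← e.map_adj_iff]
    rcases hex : e x with i | i
    · exact absurd ⟨i, by simp [← hex]⟩ hx
    · rcases hey : e y with j | j
      · have : y = e.symm (.inl l₀) ↔ j = l₀ := by
          rw [← e.injective.eq_iff, hey]
          simp
        rw [this]
        rfl
      · have : ¬ y = e.symm (.inl l₀) := by
          rintro rfl
          simp at hey
        exact iff_of_false (fun h => h) this

/-- Lets symmetric attachment vertices be exchanged; needed only for the diamond, whose extremal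
weights may sit at either vertex of a symmetric pair. -/
lemma Isom.trans_attachPendants (h : Isom G (attachPendants H l₀ p)) (σ : H ≃g H) : Isom G (attachPendants H (σ l₀) p) := by
  obtain ⟨e⟩ := h
  refine ⟨e.trans ⟨Equiv.sumCongr σ.toEquiv (Equiv.refl _), ?_⟩⟩
  rintro (i | i) (j | j)
  · exact σ.map_adj_iff
  · exact σ.injective.eq_iff
  · exact σ.injective.eq_iff
  · exact Iff.rfl

end Pendants

/-! ### The eight patterns and their gap formulas -/

namespace BicyclicPattern

variable {k : ℕ} (P : BicyclicPattern k)

/-- Separates the finite data of the pattern, which can be decided, from the unknown weights. -/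
lemma gap_eq (w : Fin k → ℕ) (t : Fin (k + 1)) (b : ℤ) (c : Fin k → ℤ)
    (hb : ∑ s, ((min (P.d (P.edge s).1 (P.edge t).1) (P.d (P.edge s).2 (P.edge t).1) : ℕ) -
      (min (P.d (P.edge s).1 (P.edge t).2) (P.d (P.edge s).2 (P.edge t).2) : ℕ) : ℤ) = b)
    (hc : ∀ l, (P.d l (P.edge t).1 : ℤ) - P.d l (P.edge t).2 = c l) :
    P.gap w t = b + ∑ l, c l * w l := by
  simp only [gap, hb, hc]

lemma defect_eq (w : Fin k → ℕ) :
    P.defect w = (k + 1) * (k + ∑ l, (w l : ℤ)) - ∑ t, |P.gap w t| := by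
  rw [defect, Finset.sum_sub_distrib]
  simp

end BicyclicPattern

open BicyclicPattern

/-- `Θ(1,2,2)`. -/
def diamondPattern : BicyclicPattern 4 where
  edge := ![(0, 1), (0, 2), (2, 1), (0, 3), (3, 1)]
  d := ![![0, 1, 1, 1], ![1, 0, 1, 1], ![1, 1, 0, 2], ![1, 1, 2, 0]]
  edge_inj := by decide
  d_self := by decide
  d_lip := by decide
  d_step := by decide
  two_nbrs := by decide

/-- Two triangles sharing a vertex. -/
def twoTrianglesPattern : BicyclicPattern 5 where
  edge := ![(0, 1), (1, 2), (2, 0), (0, 3), (3, 4), (4, 0)]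
  d := ![![0, 1, 1, 1, 1], ![1, 0, 1, 2, 2], ![1, 1, 0, 2, 2], ![1, 2, 2, 0, 1], ![1, 2, 2, 1, 0]]
  edge_inj := by decide
  d_self := by decide
  d_lip := by decide
  d_step := by decide
  two_nbrs := by decide

/-- A 4-cycle and a triangle sharing a vertex. -/
def squareTrianglePattern : BicyclicPattern 6 where
  edge := ![(0, 1), (1, 2), (2, 3), (3, 0), (0, 4), (4, 5), (5, 0)]
  d := ![![0, 1, 2, 1, 1, 1], ![1, 0, 1, 2, 2, 2], ![2, 1, 0, 1, 3, 3], ![1, 2, 1, 0, 2, 2], ![1, 2, 3, 2, 0, 1], ![1, 2, 3, 2, 1, 0]]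
  edge_inj := by decide
  d_self := by decide
  d_lip := by decide
  d_step := by decide
  two_nbrs := by decide

/-- Two 4-cycles sharing a vertex. -/
def twoSquaresPattern : BicyclicPattern 7 where
  edge := ![(0, 1), (1, 2), (2, 3), (3, 0), (0, 4), (4, 5), (5, 6), (6, 0)]
  d := ![![0, 1, 2, 1, 1, 2, 1], ![1, 0, 1, 2, 2, 3, 2], ![2, 1, 0, 1, 3, 4, 3], ![1, 2, 1, 0, 2, 3, 2], ![1, 2, 3, 2, 0, 1, 2], ![2, 3, 4, 3, 1, 0, 1], ![1, 2, 3, 2, 2, 1, 0]]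
  edge_inj := by decide
  d_self := by decide
  d_lip := by decide
  d_step := by decide
  two_nbrs := by decide

/-- `Θ(2,2,2)`. -/
def thetaTwoPattern : BicyclicPattern 5 where
  edge := ![(0, 2), (2, 1), (0, 3), (3, 1), (0, 4), (4, 1)]
  d := ![![0, 2, 1, 1, 1], ![2, 0, 1, 1, 1], ![1, 1, 0, 2, 2], ![1, 1, 2, 0, 2], ![1, 1, 2, 2, 0]]
  edge_inj := by decide
  d_self := by decide
  d_lip := by decide
  d_step := by decide
  two_nbrs := by decide

/-- `Θ(1,2,3)`. -/
def housePattern : BicyclicPattern 5 where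
  edge := ![(0, 1), (1, 2), (2, 0), (0, 3), (3, 4), (4, 1)]
  d := ![![0, 1, 1, 1, 2], ![1, 0, 1, 2, 1], ![1, 1, 0, 2, 2], ![1, 2, 2, 0, 1], ![2, 1, 2, 1, 0]]
  edge_inj := by decide
  d_self := by decide
  d_lip := by decide
  d_step := by decide
  two_nbrs := by decide

/-- `Θ(1,3,3)`. -/
def dominoPattern : BicyclicPattern 6 where
  edge := ![(0, 1), (1, 2), (2, 3), (3, 0), (0, 4), (4, 5), (5, 1)]
  d := ![![0, 1, 2, 1, 1, 2], ![1, 0, 1, 2, 2, 1], ![2, 1, 0, 1, 3, 2], ![1, 2, 1, 0, 2, 3], ![1, 2, 3, 2, 0, 1], ![2, 1, 2, 3, 1, 0]]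
  edge_inj := by decide
  d_self := by decide
  d_lip := by decide
  d_step := by decide
  two_nbrs := by decide

/-- `Θ(2,2,3)`. -/
def thetaTwoTwoThreePattern : BicyclicPattern 6 where
  edge := ![(0, 1), (1, 2), (2, 3), (3, 0), (0, 4), (4, 5), (5, 2)]
  d := ![![0, 1, 2, 1, 1, 2], ![1, 0, 1, 2, 2, 2], ![2, 1, 0, 1, 2, 1], ![1, 2, 1, 0, 2, 2], ![1, 2, 2, 2, 0, 1], ![2, 2, 1, 2, 1, 0]]
  edge_inj := by decide
  d_self := by decide
  d_lip := by decide
  d_step := by decide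
  two_nbrs := by decide

lemma diamondPattern_gap (w : Fin 4 → ℕ) :
    diamondPattern.gap w 0 = 0 - w 0 + w 1 ∧
    diamondPattern.gap w 1 = -1 - w 0 + w 2 - w 3 ∧
    diamondPattern.gap w 2 = 1 + w 1 - w 2 + w 3 ∧
    diamondPattern.gap w 3 = -1 - w 0 - w 2 + w 3 ∧
    diamondPattern.gap w 4 = 1 + w 1 + w 2 - w 3 := by
  refine ⟨(diamondPattern.gap_eq w 0 (0) ![-1, 1, 0, 0] (by decide) (by decide)).trans ?_,
    (diamondPattern.gap_eq w 1 (-1) ![-1, 0, 1, -1] (by decide) (by decide)).trans ?_,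
    (diamondPattern.gap_eq w 2 (1) ![0, 1, -1, 1] (by decide) (by decide)).trans ?_,
    (diamondPattern.gap_eq w 3 (-1) ![-1, 0, -1, 1] (by decide) (by decide)).trans ?_,
    (diamondPattern.gap_eq w 4 (1) ![0, 1, 1, -1] (by decide) (by decide)).trans ?_⟩ <;>
  · simp [Fin.sum_univ_four]
    try ring

lemma twoTrianglesPattern_gap (w : Fin 5 → ℕ) :
    twoTrianglesPattern.gap w 0 = -3 - w 0 + w 1 - w 3 - w 4 ∧
    twoTrianglesPattern.gap w 1 = 0 - w 1 + w 2 ∧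
    twoTrianglesPattern.gap w 2 = 3 + w 0 - w 2 + w 3 + w 4 ∧
    twoTrianglesPattern.gap w 3 = -3 - w 0 - w 1 - w 2 + w 3 ∧
    twoTrianglesPattern.gap w 4 = 0 - w 3 + w 4 ∧
    twoTrianglesPattern.gap w 5 = 3 + w 0 + w 1 + w 2 - w 4 := by
  refine ⟨(twoTrianglesPattern.gap_eq w 0 (-3) ![-1, 1, 0, -1, -1] (by decide) (by decide)).trans ?_,
    (twoTrianglesPattern.gap_eq w 1 (0) ![0, -1, 1, 0, 0] (by decide) (by decide)).trans ?_,
    (twoTrianglesPattern.gap_eq w 2 (3) ![1, 0, -1, 1, 1] (by decide) (by decide)).trans ?_,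
    (twoTrianglesPattern.gap_eq w 3 (-3) ![-1, -1, -1, 1, 0] (by decide) (by decide)).trans ?_,
    (twoTrianglesPattern.gap_eq w 4 (0) ![0, 0, 0, -1, 1] (by decide) (by decide)).trans ?_,
    (twoTrianglesPattern.gap_eq w 5 (3) ![1, 1, 1, 0, -1] (by decide) (by decide)).trans ?_⟩ <;>
  · simp [Fin.sum_univ_five]
    try ring

lemma squareTrianglePattern_gap (w : Fin 6 → ℕ) :
    squareTrianglePattern.gap w 0 = -3 - w 0 + w 1 + w 2 - w 3 - w 4 - w 5 ∧
    squareTrianglePattern.gap w 1 = -3 - w 0 - w 1 + w 2 + w 3 - w 4 - w 5 ∧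
    squareTrianglePattern.gap w 2 = 3 + w 0 - w 1 - w 2 + w 3 + w 4 + w 5 ∧
    squareTrianglePattern.gap w 3 = 3 + w 0 + w 1 - w 2 - w 3 + w 4 + w 5 ∧
    squareTrianglePattern.gap w 4 = -4 - w 0 - w 1 - w 2 - w 3 + w 4 ∧
    squareTrianglePattern.gap w 5 = 0 - w 4 + w 5 ∧
    squareTrianglePattern.gap w 6 = 4 + w 0 + w 1 + w 2 + w 3 - w 5 := by
  refine ⟨(squareTrianglePattern.gap_eq w 0 (-3) ![-1, 1, 1, -1, -1, -1] (by decide) (by decide)).trans ?_,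
    (squareTrianglePattern.gap_eq w 1 (-3) ![-1, -1, 1, 1, -1, -1] (by decide) (by decide)).trans ?_,
    (squareTrianglePattern.gap_eq w 2 (3) ![1, -1, -1, 1, 1, 1] (by decide) (by decide)).trans ?_,
    (squareTrianglePattern.gap_eq w 3 (3) ![1, 1, -1, -1, 1, 1] (by decide) (by decide)).trans ?_,
    (squareTrianglePattern.gap_eq w 4 (-4) ![-1, -1, -1, -1, 1, 0] (by decide) (by decide)).trans ?_,
    (squareTrianglePattern.gap_eq w 5 (0) ![0, 0, 0, 0, -1, 1] (by decide) (by decide)).trans ?_,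
    (squareTrianglePattern.gap_eq w 6 (4) ![1, 1, 1, 1, 0, -1] (by decide) (by decide)).trans ?_⟩ <;>
  · simp [Fin.sum_univ_six]
    try ring

lemma twoSquaresPattern_gap (w : Fin 7 → ℕ) :
    twoSquaresPattern.gap w 0 = -4 - w 0 + w 1 + w 2 - w 3 - w 4 - w 5 - w 6 ∧
    twoSquaresPattern.gap w 1 = -4 - w 0 - w 1 + w 2 + w 3 - w 4 - w 5 - w 6 ∧
    twoSquaresPattern.gap w 2 = 4 + w 0 - w 1 - w 2 + w 3 + w 4 + w 5 + w 6 ∧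
    twoSquaresPattern.gap w 3 = 4 + w 0 + w 1 - w 2 - w 3 + w 4 + w 5 + w 6 ∧
    twoSquaresPattern.gap w 4 = -4 - w 0 - w 1 - w 2 - w 3 + w 4 + w 5 - w 6 ∧
    twoSquaresPattern.gap w 5 = -4 - w 0 - w 1 - w 2 - w 3 - w 4 + w 5 + w 6 ∧
    twoSquaresPattern.gap w 6 = 4 + w 0 + w 1 + w 2 + w 3 - w 4 - w 5 + w 6 ∧
    twoSquaresPattern.gap w 7 = 4 + w 0 + w 1 + w 2 + w 3 + w 4 - w 5 - w 6 := by
  refine ⟨(twoSquaresPattern.gap_eq w 0 (-4) ![-1, 1, 1, -1, -1, -1, -1] (by decide) (by decide)).trans ?_,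
    (twoSquaresPattern.gap_eq w 1 (-4) ![-1, -1, 1, 1, -1, -1, -1] (by decide) (by decide)).trans ?_,
    (twoSquaresPattern.gap_eq w 2 (4) ![1, -1, -1, 1, 1, 1, 1] (by decide) (by decide)).trans ?_,
    (twoSquaresPattern.gap_eq w 3 (4) ![1, 1, -1, -1, 1, 1, 1] (by decide) (by decide)).trans ?_,
    (twoSquaresPattern.gap_eq w 4 (-4) ![-1, -1, -1, -1, 1, 1, -1] (by decide) (by decide)).trans ?_,
    (twoSquaresPattern.gap_eq w 5 (-4) ![-1, -1, -1, -1, -1, 1, 1] (by decide) (by decide)).trans ?_,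
    (twoSquaresPattern.gap_eq w 6 (4) ![1, 1, 1, 1, -1, -1, 1] (by decide) (by decide)).trans ?_,
    (twoSquaresPattern.gap_eq w 7 (4) ![1, 1, 1, 1, 1, -1, -1] (by decide) (by decide)).trans ?_⟩ <;>
  · simp [Fin.sum_univ_seven]
    try ring

lemma thetaTwoPattern_gap (w : Fin 5 → ℕ) :
    thetaTwoPattern.gap w 0 = -1 - w 0 + w 1 + w 2 - w 3 - w 4 ∧
    thetaTwoPattern.gap w 1 = 1 - w 0 + w 1 - w 2 + w 3 + w 4 ∧
    thetaTwoPattern.gap w 2 = -1 - w 0 + w 1 - w 2 + w 3 - w 4 ∧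
    thetaTwoPattern.gap w 3 = 1 - w 0 + w 1 + w 2 - w 3 + w 4 ∧
    thetaTwoPattern.gap w 4 = -1 - w 0 + w 1 - w 2 - w 3 + w 4 ∧
    thetaTwoPattern.gap w 5 = 1 - w 0 + w 1 + w 2 + w 3 - w 4 := by
  refine ⟨(thetaTwoPattern.gap_eq w 0 (-1) ![-1, 1, 1, -1, -1] (by decide) (by decide)).trans ?_,
    (thetaTwoPattern.gap_eq w 1 (1) ![-1, 1, -1, 1, 1] (by decide) (by decide)).trans ?_,
    (thetaTwoPattern.gap_eq w 2 (-1) ![-1, 1, -1, 1, -1] (by decide) (by decide)).trans ?_,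
    (thetaTwoPattern.gap_eq w 3 (1) ![-1, 1, 1, -1, 1] (by decide) (by decide)).trans ?_,
    (thetaTwoPattern.gap_eq w 4 (-1) ![-1, 1, -1, -1, 1] (by decide) (by decide)).trans ?_,
    (thetaTwoPattern.gap_eq w 5 (1) ![-1, 1, 1, 1, -1] (by decide) (by decide)).trans ?_⟩ <;>
  · simp [Fin.sum_univ_five]
    try ring

lemma housePattern_gap (w : Fin 5 → ℕ) :
    housePattern.gap w 0 = 0 - w 0 + w 1 - w 3 + w 4 ∧
    housePattern.gap w 1 = -2 - w 1 + w 2 - w 4 ∧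
    housePattern.gap w 2 = 2 + w 0 - w 2 + w 3 ∧
    housePattern.gap w 3 = -2 - w 0 - w 1 - w 2 + w 3 + w 4 ∧
    housePattern.gap w 4 = 0 - w 0 + w 1 - w 3 + w 4 ∧
    housePattern.gap w 5 = 2 + w 0 + w 1 + w 2 - w 3 - w 4 := by
  refine ⟨(housePattern.gap_eq w 0 (0) ![-1, 1, 0, -1, 1] (by decide) (by decide)).trans ?_,
    (housePattern.gap_eq w 1 (-2) ![0, -1, 1, 0, -1] (by decide) (by decide)).trans ?_,
    (housePattern.gap_eq w 2 (2) ![1, 0, -1, 1, 0] (by decide) (by decide)).trans ?_,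
    (housePattern.gap_eq w 3 (-2) ![-1, -1, -1, 1, 1] (by decide) (by decide)).trans ?_,
    (housePattern.gap_eq w 4 (0) ![-1, 1, 0, -1, 1] (by decide) (by decide)).trans ?_,
    (housePattern.gap_eq w 5 (2) ![1, 1, 1, -1, -1] (by decide) (by decide)).trans ?_⟩ <;>
  · simp [Fin.sum_univ_five]
    try ring

lemma dominoPattern_gap (w : Fin 6 → ℕ) :
    dominoPattern.gap w 0 = 0 - w 0 + w 1 + w 2 - w 3 - w 4 + w 5 ∧
    dominoPattern.gap w 1 = -3 - w 0 - w 1 + w 2 + w 3 - w 4 - w 5 ∧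
    dominoPattern.gap w 2 = 0 + w 0 - w 1 - w 2 + w 3 + w 4 - w 5 ∧
    dominoPattern.gap w 3 = 3 + w 0 + w 1 - w 2 - w 3 + w 4 + w 5 ∧
    dominoPattern.gap w 4 = -3 - w 0 - w 1 - w 2 - w 3 + w 4 + w 5 ∧
    dominoPattern.gap w 5 = 0 - w 0 + w 1 + w 2 - w 3 - w 4 + w 5 ∧
    dominoPattern.gap w 6 = 3 + w 0 + w 1 + w 2 + w 3 - w 4 - w 5 := by
  refine ⟨(dominoPattern.gap_eq w 0 (0) ![-1, 1, 1, -1, -1, 1] (by decide) (by decide)).trans ?_,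
    (dominoPattern.gap_eq w 1 (-3) ![-1, -1, 1, 1, -1, -1] (by decide) (by decide)).trans ?_,
    (dominoPattern.gap_eq w 2 (0) ![1, -1, -1, 1, 1, -1] (by decide) (by decide)).trans ?_,
    (dominoPattern.gap_eq w 3 (3) ![1, 1, -1, -1, 1, 1] (by decide) (by decide)).trans ?_,
    (dominoPattern.gap_eq w 4 (-3) ![-1, -1, -1, -1, 1, 1] (by decide) (by decide)).trans ?_,
    (dominoPattern.gap_eq w 5 (0) ![-1, 1, 1, -1, -1, 1] (by decide) (by decide)).trans ?_,
    (dominoPattern.gap_eq w 6 (3) ![1, 1, 1, 1, -1, -1] (by decide) (by decide)).trans ?_⟩ <;>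
  · simp [Fin.sum_univ_six]
    try ring

lemma thetaTwoTwoThreePattern_gap (w : Fin 6 → ℕ) :
    thetaTwoTwoThreePattern.gap w 0 = -1 - w 0 + w 1 + w 2 - w 3 - w 4 ∧
    thetaTwoTwoThreePattern.gap w 1 = 1 - w 0 - w 1 + w 2 + w 3 + w 5 ∧
    thetaTwoTwoThreePattern.gap w 2 = -1 + w 0 - w 1 - w 2 + w 3 - w 5 ∧
    thetaTwoTwoThreePattern.gap w 3 = 1 + w 0 + w 1 - w 2 - w 3 + w 4 ∧
    thetaTwoTwoThreePattern.gap w 4 = -2 - w 0 - w 1 - w 3 + w 4 + w 5 ∧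
    thetaTwoTwoThreePattern.gap w 5 = 0 - w 0 + w 2 - w 4 + w 5 ∧
    thetaTwoTwoThreePattern.gap w 6 = 2 + w 1 + w 2 + w 3 - w 4 - w 5 := by
  refine ⟨(thetaTwoTwoThreePattern.gap_eq w 0 (-1) ![-1, 1, 1, -1, -1, 0] (by decide) (by decide)).trans ?_,
    (thetaTwoTwoThreePattern.gap_eq w 1 (1) ![-1, -1, 1, 1, 0, 1] (by decide) (by decide)).trans ?_,
    (thetaTwoTwoThreePattern.gap_eq w 2 (-1) ![1, -1, -1, 1, 0, -1] (by decide) (by decide)).trans ?_,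
    (thetaTwoTwoThreePattern.gap_eq w 3 (1) ![1, 1, -1, -1, 1, 0] (by decide) (by decide)).trans ?_,
    (thetaTwoTwoThreePattern.gap_eq w 4 (-2) ![-1, -1, 0, -1, 1, 1] (by decide) (by decide)).trans ?_,
    (thetaTwoTwoThreePattern.gap_eq w 5 (0) ![-1, 0, 1, 0, -1, 1] (by decide) (by decide)).trans ?_,
    (thetaTwoTwoThreePattern.gap_eq w 6 (2) ![0, 1, 1, 1, -1, -1] (by decide) (by decide)).trans ?_⟩ <;>
  · simp [Fin.sum_univ_six]
    try ring

/-! ### Lower bounds for the defects, with equality cases -/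

lemma housePattern_defect (w : Fin 5 → ℕ) :
    22 + ∑ l, (w l : ℤ) ≤ housePattern.defect w := by
  obtain ⟨g0, g1, g2, g3, g4, g5⟩ := housePattern_gap w
  have hs : ∑ t, |housePattern.gap w t| = _ :=
    Fin.sum_univ_six fun t : Fin 6 => |housePattern.gap w t|
  rw [defect_eq, hs, Fin.sum_univ_five]
  -- The edges of the triangle have to be treated together: their gaps sum to zero, so the absolute
  -- values add up to twice the largest one. The total is m + 16 because m = 6 + ∑ w.
  have h : |housePattern.gap w 0| + |housePattern.gap w 1| + |housePattern.gap w 2| ≤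
      4 + 2 * (w 0 + w 1 + w 2 + w 3 + w 4 : ℤ) := by
    rw [g0, g1, g2]
    simp only [abs_eq_max_neg]
    clear * -
    omega
  have h3 : |housePattern.gap w 3| ≤ 2 + (w 0 + w 1 + w 2 + w 3 + w 4 : ℤ) := by
    rw [g3, abs_le]
    clear * -
    omega
  have h4 : |housePattern.gap w 4| ≤ (w 0 + w 1 + w 2 + w 3 + w 4 : ℤ) := by
    rw [g4, abs_le]
    clear * -
    omega
  have h5 : |housePattern.gap w 5| ≤ 2 + (w 0 + w 1 + w 2 + w 3 + w 4 : ℤ) := by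
    rw [g5, abs_le]
    clear * -
    omega
  push_cast
  linarith

lemma dominoPattern_defect (w : Fin 6 → ℕ) : 30 ≤ dominoPattern.defect w := by
  obtain ⟨g0, g1, g2, g3, g4, g5, g6⟩ := dominoPattern_gap w
  have hs : ∑ t, |dominoPattern.gap w t| = _ :=
    Fin.sum_univ_seven fun t : Fin 7 => |dominoPattern.gap w t|
  rw [defect_eq, hs, Fin.sum_univ_six]
  have h0 : |dominoPattern.gap w 0| ≤ (w 0 + w 1 + w 2 + w 3 + w 4 + w 5 : ℤ) := by
    rw [g0, abs_le]
    clear * -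
    omega
  have h1 : |dominoPattern.gap w 1| ≤ 3 + (w 0 + w 1 + w 2 + w 3 + w 4 + w 5 : ℤ) := by
    rw [g1, abs_le]
    clear * -
    omega
  have h2 : |dominoPattern.gap w 2| ≤ (w 0 + w 1 + w 2 + w 3 + w 4 + w 5 : ℤ) := by
    rw [g2, abs_le]
    clear * -
    omega
  have h3 : |dominoPattern.gap w 3| ≤ 3 + (w 0 + w 1 + w 2 + w 3 + w 4 + w 5 : ℤ) := by
    rw [g3, abs_le]
    clear * -
    omega
  have h4 : |dominoPattern.gap w 4| ≤ 3 + (w 0 + w 1 + w 2 + w 3 + w 4 + w 5 : ℤ) := by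
    rw [g4, abs_le]
    clear * -
    omega
  have h5 : |dominoPattern.gap w 5| ≤ (w 0 + w 1 + w 2 + w 3 + w 4 + w 5 : ℤ) := by
    rw [g5, abs_le]
    clear * -
    omega
  have h6 : |dominoPattern.gap w 6| ≤ 3 + (w 0 + w 1 + w 2 + w 3 + w 4 + w 5 : ℤ) := by
    rw [g6, abs_le]
    clear * -
    omega
  push_cast
  linarith

lemma thetaTwoTwoThreePattern_defect (w : Fin 6 → ℕ) : 28 ≤ thetaTwoTwoThreePattern.defect w := by
  obtain ⟨g0, g1, g2, g3, g4, g5, g6⟩ := thetaTwoTwoThreePattern_gap w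
  have hs : ∑ t, |thetaTwoTwoThreePattern.gap w t| = _ :=
    Fin.sum_univ_seven fun t : Fin 7 => |thetaTwoTwoThreePattern.gap w t|
  rw [defect_eq, hs, Fin.sum_univ_six]
  have key : ∀ x : ℤ, x ≤ 2 + (w 0 + w 1 + w 2 + w 3 + w 4 + w 5 : ℤ) →
      -x ≤ 2 + (w 0 + w 1 + w 2 + w 3 + w 4 + w 5 : ℤ) →
      |x| ≤ 2 + (w 0 + w 1 + w 2 + w 3 + w 4 + w 5 : ℤ) := fun x h1 h2 => abs_le'.2 ⟨h1, h2⟩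
  have h0 := key (thetaTwoTwoThreePattern.gap w 0) (by rw [g0]; clear * -; omega) (by rw [g0]; clear * -; omega)
  have h1 := key (thetaTwoTwoThreePattern.gap w 1) (by rw [g1]; clear * -; omega) (by rw [g1]; clear * -; omega)
  have h2 := key (thetaTwoTwoThreePattern.gap w 2) (by rw [g2]; clear * -; omega) (by rw [g2]; clear * -; omega)
  have h3 := key (thetaTwoTwoThreePattern.gap w 3) (by rw [g3]; clear * -; omega) (by rw [g3]; clear * -; omega)
  have h4 := key (thetaTwoTwoThreePattern.gap w 4) (by rw [g4]; clear * -; omega) (by rw [g4]; clear * -; omega)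
  have h5 := key (thetaTwoTwoThreePattern.gap w 5) (by rw [g5]; clear * -; omega) (by rw [g5]; clear * -; omega)
  have h6 := key (thetaTwoTwoThreePattern.gap w 6) (by rw [g6]; clear * -; omega) (by rw [g6]; clear * -; omega)
  push_cast
  linarith

/-- The two edges of each path between the hubs are estimated together. A path whose pair of gaps
attains the bound 2 + 2 ∑ w carries no weight at its middle vertex or at the hubs, so any weight
spoils at least one of the three pairs. The bare pattern does attain 24. -/
lemma thetaTwoPattern_defect (w : Fin 5 → ℕ) :
    24 ≤ thetaTwoPattern.defect w ∧ (0 < ∑ l, (w l : ℤ) → 25 ≤ thetaTwoPattern.defect w) := by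
  obtain ⟨g0, g1, g2, g3, g4, g5⟩ := thetaTwoPattern_gap w
  have hs : ∑ t, |thetaTwoPattern.gap w t| = _ :=
    Fin.sum_univ_six fun t : Fin 6 => |thetaTwoPattern.gap w t|
  rw [defect_eq, hs, Fin.sum_univ_five]
  have h2 : |thetaTwoPattern.gap w 0| + |thetaTwoPattern.gap w 1| ≤
        2 + 2 * (w 0 + w 1 + w 2 + w 3 + w 4 : ℤ) ∧ (0 < w 0 + w 1 + w 2 →
      |thetaTwoPattern.gap w 0| + |thetaTwoPattern.gap w 1| ≤
        2 * (w 0 + w 1 + w 2 + w 3 + w 4 : ℤ)) := by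
    rw [g0, g1]
    simp only [abs_eq_max_neg]
    clear * -
    omega
  have h3 : |thetaTwoPattern.gap w 2| + |thetaTwoPattern.gap w 3| ≤
        2 + 2 * (w 0 + w 1 + w 2 + w 3 + w 4 : ℤ) ∧ (0 < w 0 + w 1 + w 3 →
      |thetaTwoPattern.gap w 2| + |thetaTwoPattern.gap w 3| ≤
        2 * (w 0 + w 1 + w 2 + w 3 + w 4 : ℤ)) := by
    rw [g2, g3]
    simp only [abs_eq_max_neg]
    clear * -
    omega
  have h4 : |thetaTwoPattern.gap w 4| + |thetaTwoPattern.gap w 5| ≤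
        2 + 2 * (w 0 + w 1 + w 2 + w 3 + w 4 : ℤ) ∧ (0 < w 0 + w 1 + w 4 →
      |thetaTwoPattern.gap w 4| + |thetaTwoPattern.gap w 5| ≤
        2 * (w 0 + w 1 + w 2 + w 3 + w 4 : ℤ)) := by
    rw [g4, g5]
    simp only [abs_eq_max_neg]
    clear * -
    omega
  clear g0 g1 g2 g3 g4 g5 hs
  push_cast
  refine ⟨by linarith [h2.1, h3.1, h4.1], fun hpos => ?_⟩
  omega

/-- Each gap is at most 4 + ∑ w, and 8(7 + ∑ w) - 8(4 + ∑ w) = 24. Weight away from the common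
vertex occurs with opposite signs on some edges and breaks equality there. -/
lemma twoSquaresPattern_defect (w : Fin 7 → ℕ) :
    24 ≤ twoSquaresPattern.defect w ∧
      (twoSquaresPattern.defect w = 24 → ∀ l, l ≠ 0 → w l = 0) := by
  obtain ⟨g0, g1, g2, g3, g4, g5, g6, g7⟩ := twoSquaresPattern_gap w
  have hs : ∑ t, |twoSquaresPattern.gap w t| = _ :=
    Fin.sum_univ_eight fun t : Fin 8 => |twoSquaresPattern.gap w t|
  rw [defect_eq, hs, Fin.sum_univ_seven]
  have key : ∀ x : ℤ, x ≤ 4 + (w 0 + w 1 + w 2 + w 3 + w 4 + w 5 + w 6 : ℤ) →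
      -x ≤ 4 + (w 0 + w 1 + w 2 + w 3 + w 4 + w 5 + w 6 : ℤ) →
      |x| ≤ 4 + (w 0 + w 1 + w 2 + w 3 + w 4 + w 5 + w 6 : ℤ) := fun x h1 h2 => abs_le'.2 ⟨h1, h2⟩
  have h0 := key (twoSquaresPattern.gap w 0) (by rw [g0]; clear * -; omega) (by rw [g0]; clear * -; omega)
  have h1 := key (twoSquaresPattern.gap w 1) (by rw [g1]; clear * -; omega) (by rw [g1]; clear * -; omega)
  have h2 := key (twoSquaresPattern.gap w 2) (by rw [g2]; clear * -; omega) (by rw [g2]; clear * -; omega)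
  have h3 := key (twoSquaresPattern.gap w 3) (by rw [g3]; clear * -; omega) (by rw [g3]; clear * -; omega)
  have h4 := key (twoSquaresPattern.gap w 4) (by rw [g4]; clear * -; omega) (by rw [g4]; clear * -; omega)
  have h5 := key (twoSquaresPattern.gap w 5) (by rw [g5]; clear * -; omega) (by rw [g5]; clear * -; omega)
  have h6 := key (twoSquaresPattern.gap w 6) (by rw [g6]; clear * -; omega) (by rw [g6]; clear * -; omega)
  have h7 := key (twoSquaresPattern.gap w 7) (by rw [g7]; clear * -; omega) (by rw [g7]; clear * -; omega)
  have e0 : |twoSquaresPattern.gap w 0| = 4 + (w 0 + w 1 + w 2 + w 3 + w 4 + w 5 + w 6 : ℤ) →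
      w 1 = 0 ∧ w 2 = 0 := by
    rw [g0, abs_eq_max_neg]
    clear * -
    omega
  have e3 : |twoSquaresPattern.gap w 3| = 4 + (w 0 + w 1 + w 2 + w 3 + w 4 + w 5 + w 6 : ℤ) →
      w 3 = 0 := by
    rw [g3, abs_eq_max_neg]
    clear * -
    omega
  have e4 : |twoSquaresPattern.gap w 4| = 4 + (w 0 + w 1 + w 2 + w 3 + w 4 + w 5 + w 6 : ℤ) →
      w 4 = 0 ∧ w 5 = 0 := by
    rw [g4, abs_eq_max_neg]
    clear * -
    omega
  have e7 : |twoSquaresPattern.gap w 7| = 4 + (w 0 + w 1 + w 2 + w 3 + w 4 + w 5 + w 6 : ℤ) →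
      w 6 = 0 := by
    rw [g7, abs_eq_max_neg]
    clear * -
    omega
  push_cast
  refine ⟨by linarith, fun heq l hl => ?_⟩
  · have k0 := e0 (by linarith)
    have k3 := e3 (by linarith)
    have k4 := e4 (by linarith)
    have k7 := e7 (by linarith)
    fin_cases l
    exacts [absurd rfl hl, k0.1, k0.2, k3, k4.1, k4.2, k7]

lemma twoSquaresPattern_defect_eq (w : Fin 7 → ℕ) (hw : ∀ l, l ≠ 0 → w l = 0) :
    twoSquaresPattern.defect w = 24 := by
  obtain ⟨g0, g1, g2, g3, g4, g5, g6, g7⟩ := twoSquaresPattern_gap w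
  have hs : ∑ t, |twoSquaresPattern.gap w t| = _ :=
    Fin.sum_univ_eight fun t : Fin 8 => |twoSquaresPattern.gap w t|
  rw [defect_eq, hs, Fin.sum_univ_seven]
  clear hs
  have z1 := hw 1 (by decide)
  have z2 := hw 2 (by decide)
  have z3 := hw 3 (by decide)
  have z4 := hw 4 (by decide)
  have z5 := hw 5 (by decide)
  have z6 := hw 6 (by decide)
  have f0 : |twoSquaresPattern.gap w 0| = 4 + (w 0 : ℤ) :=
    (abs_eq (by clear * -; omega)).2 (by rw [g0]; clear * - z1 z2 z3 z4 z5 z6; omega)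
  have f1 : |twoSquaresPattern.gap w 1| = 4 + (w 0 : ℤ) :=
    (abs_eq (by clear * -; omega)).2 (by rw [g1]; clear * - z1 z2 z3 z4 z5 z6; omega)
  have f2 : |twoSquaresPattern.gap w 2| = 4 + (w 0 : ℤ) :=
    (abs_eq (by clear * -; omega)).2 (by rw [g2]; clear * - z1 z2 z3 z4 z5 z6; omega)
  have f3 : |twoSquaresPattern.gap w 3| = 4 + (w 0 : ℤ) :=
    (abs_eq (by clear * -; omega)).2 (by rw [g3]; clear * - z1 z2 z3 z4 z5 z6; omega)
  have f4 : |twoSquaresPattern.gap w 4| = 4 + (w 0 : ℤ) :=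
    (abs_eq (by clear * -; omega)).2 (by rw [g4]; clear * - z1 z2 z3 z4 z5 z6; omega)
  have f5 : |twoSquaresPattern.gap w 5| = 4 + (w 0 : ℤ) :=
    (abs_eq (by clear * -; omega)).2 (by rw [g5]; clear * - z1 z2 z3 z4 z5 z6; omega)
  have f6 : |twoSquaresPattern.gap w 6| = 4 + (w 0 : ℤ) :=
    (abs_eq (by clear * -; omega)).2 (by rw [g6]; clear * - z1 z2 z3 z4 z5 z6; omega)
  have f7 : |twoSquaresPattern.gap w 7| = 4 + (w 0 : ℤ) :=
    (abs_eq (by clear * -; omega)).2 (by rw [g7]; clear * - z1 z2 z3 z4 z5 z6; omega)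
  rw [f0, f1, f2, f3, f4, f5, f6, f7]
  push_cast
  simp only [z1, z2, z3, z4, z5, z6]
  push_cast
  ring

/-- The triangle is estimated as a whole and the square edge by edge; the bound is m + 15 because m
= 7 + ∑ w. -/
lemma squareTrianglePattern_defect (w : Fin 6 → ℕ) :
    22 + ∑ l, (w l : ℤ) ≤ squareTrianglePattern.defect w ∧
      (squareTrianglePattern.defect w = 22 + ∑ l, (w l : ℤ) → ∀ l, l ≠ 0 → w l = 0) := by
  obtain ⟨g0, g1, g2, g3, g4, g5, g6⟩ := squareTrianglePattern_gap w
  have hs : ∑ t, |squareTrianglePattern.gap w t| = _ :=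
    Fin.sum_univ_seven fun t : Fin 7 => |squareTrianglePattern.gap w t|
  rw [defect_eq, hs, Fin.sum_univ_six]
  have h : |squareTrianglePattern.gap w 4| + |squareTrianglePattern.gap w 5| +
      |squareTrianglePattern.gap w 6| ≤ 8 + 2 * (w 0 + w 1 + w 2 + w 3 + w 4 + w 5 : ℤ) ∧
      (|squareTrianglePattern.gap w 4| + |squareTrianglePattern.gap w 5| +
        |squareTrianglePattern.gap w 6| = 8 + 2 * (w 0 + w 1 + w 2 + w 3 + w 4 + w 5 : ℤ) →
        w 4 = 0 ∧ w 5 = 0) := by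
    rw [g4, g5, g6]
    simp only [abs_eq_max_neg]
    clear * -
    omega
  have h0 : |squareTrianglePattern.gap w 0| ≤ 3 + (w 0 + w 1 + w 2 + w 3 + w 4 + w 5 : ℤ) ∧
      (|squareTrianglePattern.gap w 0| = 3 + (w 0 + w 1 + w 2 + w 3 + w 4 + w 5 : ℤ) →
        w 1 = 0 ∧ w 2 = 0) := by
    rw [g0, abs_eq_max_neg]
    clear * -
    omega
  have h1 : |squareTrianglePattern.gap w 1| ≤ 3 + (w 0 + w 1 + w 2 + w 3 + w 4 + w 5 : ℤ) := by
    rw [g1, abs_le]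
    clear * -
    omega
  have h2 : |squareTrianglePattern.gap w 2| ≤ 3 + (w 0 + w 1 + w 2 + w 3 + w 4 + w 5 : ℤ) := by
    rw [g2, abs_le]
    clear * -
    omega
  have h3 : |squareTrianglePattern.gap w 3| ≤ 3 + (w 0 + w 1 + w 2 + w 3 + w 4 + w 5 : ℤ) ∧
      (|squareTrianglePattern.gap w 3| = 3 + (w 0 + w 1 + w 2 + w 3 + w 4 + w 5 : ℤ) →
        w 3 = 0) := by
    rw [g3, abs_eq_max_neg]
    clear * -
    omega
  push_cast
  refine ⟨by linarith [h.1, h0.1, h3.1], fun heq l hl => ?_⟩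
  · have k := h.2 (by linarith [h.1, h0.1, h3.1])
    have k0 := h0.2 (by linarith [h.1, h0.1, h3.1])
    have k3 := h3.2 (by linarith [h.1, h0.1, h3.1])
    fin_cases l
    exacts [absurd rfl hl, k0.1, k0.2, k3, k.1, k.2]

lemma squareTrianglePattern_defect_eq (w : Fin 6 → ℕ) (hw : ∀ l, l ≠ 0 → w l = 0) :
    squareTrianglePattern.defect w = 22 + ∑ l, (w l : ℤ) := by
  obtain ⟨g0, g1, g2, g3, g4, g5, g6⟩ := squareTrianglePattern_gap w
  have hs : ∑ t, |squareTrianglePattern.gap w t| = _ :=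
    Fin.sum_univ_seven fun t : Fin 7 => |squareTrianglePattern.gap w t|
  rw [defect_eq, hs, Fin.sum_univ_six]
  clear hs
  have z1 := hw 1 (by decide)
  have z2 := hw 2 (by decide)
  have z3 := hw 3 (by decide)
  have z4 := hw 4 (by decide)
  have z5 := hw 5 (by decide)
  have f0 : |squareTrianglePattern.gap w 0| = 3 + (w 0 : ℤ) :=
    (abs_eq (by clear * -; omega)).2 (by rw [g0]; clear * - z1 z2 z3 z4 z5; omega)
  have f1 : |squareTrianglePattern.gap w 1| = 3 + (w 0 : ℤ) :=
    (abs_eq (by clear * -; omega)).2 (by rw [g1]; clear * - z1 z2 z3 z4 z5; omega)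
  have f2 : |squareTrianglePattern.gap w 2| = 3 + (w 0 : ℤ) :=
    (abs_eq (by clear * -; omega)).2 (by rw [g2]; clear * - z1 z2 z3 z4 z5; omega)
  have f3 : |squareTrianglePattern.gap w 3| = 3 + (w 0 : ℤ) :=
    (abs_eq (by clear * -; omega)).2 (by rw [g3]; clear * - z1 z2 z3 z4 z5; omega)
  have f4 : |squareTrianglePattern.gap w 4| = 4 + (w 0 : ℤ) :=
    (abs_eq (by clear * -; omega)).2 (by rw [g4]; clear * - z1 z2 z3 z4 z5; omega)
  have f5 : |squareTrianglePattern.gap w 5| = 0 :=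
    (abs_eq (by clear * -; omega)).2 (by rw [g5]; clear * - z1 z2 z3 z4 z5; omega)
  have f6 : |squareTrianglePattern.gap w 6| = 4 + (w 0 : ℤ) :=
    (abs_eq (by clear * -; omega)).2 (by rw [g6]; clear * - z1 z2 z3 z4 z5; omega)
  rw [f0, f1, f2, f3, f4, f5, f6]
  push_cast
  simp only [z1, z2, z3, z4, z5]
  push_cast
  ring

/-- Each triangle is estimated as a whole; the bound is 2m + 6 because m = 6 + ∑ w. -/
lemma twoTrianglesPattern_defect (w : Fin 5 → ℕ) :
    18 + 2 * ∑ l, (w l : ℤ) ≤ twoTrianglesPattern.defect w ∧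
      (twoTrianglesPattern.defect w = 18 + 2 * ∑ l, (w l : ℤ) → ∀ l, l ≠ 0 → w l = 0) := by
  obtain ⟨g0, g1, g2, g3, g4, g5⟩ := twoTrianglesPattern_gap w
  have hs : ∑ t, |twoTrianglesPattern.gap w t| = _ :=
    Fin.sum_univ_six fun t : Fin 6 => |twoTrianglesPattern.gap w t|
  rw [defect_eq, hs, Fin.sum_univ_five]
  have h : |twoTrianglesPattern.gap w 0| + |twoTrianglesPattern.gap w 1| +
      |twoTrianglesPattern.gap w 2| ≤ 6 + 2 * (w 0 + w 1 + w 2 + w 3 + w 4 : ℤ) ∧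
      (|twoTrianglesPattern.gap w 0| + |twoTrianglesPattern.gap w 1| +
        |twoTrianglesPattern.gap w 2| = 6 + 2 * (w 0 + w 1 + w 2 + w 3 + w 4 : ℤ) →
        w 1 = 0 ∧ w 2 = 0) := by
    rw [g0, g1, g2]
    simp only [abs_eq_max_neg]
    clear * -
    omega
  have h' : |twoTrianglesPattern.gap w 3| + |twoTrianglesPattern.gap w 4| +
      |twoTrianglesPattern.gap w 5| ≤ 6 + 2 * (w 0 + w 1 + w 2 + w 3 + w 4 : ℤ) ∧
      (|twoTrianglesPattern.gap w 3| + |twoTrianglesPattern.gap w 4| +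
        |twoTrianglesPattern.gap w 5| = 6 + 2 * (w 0 + w 1 + w 2 + w 3 + w 4 : ℤ) →
        w 3 = 0 ∧ w 4 = 0) := by
    rw [g3, g4, g5]
    simp only [abs_eq_max_neg]
    clear * -
    omega
  push_cast
  refine ⟨by linarith [h.1, h'.1], fun heq l hl => ?_⟩
  · have k := h.2 (by linarith [h.1, h'.1])
    have k' := h'.2 (by linarith [h.1, h'.1])
    fin_cases l
    exacts [absurd rfl hl, k.1, k.2, k'.1, k'.2]

lemma twoTrianglesPattern_defect_eq (w : Fin 5 → ℕ) (hw : ∀ l, l ≠ 0 → w l = 0) :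
    twoTrianglesPattern.defect w = 18 + 2 * ∑ l, (w l : ℤ) := by
  obtain ⟨g0, g1, g2, g3, g4, g5⟩ := twoTrianglesPattern_gap w
  have hs : ∑ t, |twoTrianglesPattern.gap w t| = _ :=
    Fin.sum_univ_six fun t : Fin 6 => |twoTrianglesPattern.gap w t|
  rw [defect_eq, hs, Fin.sum_univ_five]
  clear hs
  have z1 := hw 1 (by decide)
  have z2 := hw 2 (by decide)
  have z3 := hw 3 (by decide)
  have z4 := hw 4 (by decide)
  have f0 : |twoTrianglesPattern.gap w 0| = 3 + (w 0 : ℤ) :=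
    (abs_eq (by clear * -; omega)).2 (by rw [g0]; clear * - z1 z2 z3 z4; omega)
  have f1 : |twoTrianglesPattern.gap w 1| = 0 :=
    (abs_eq (by clear * -; omega)).2 (by rw [g1]; clear * - z1 z2 z3 z4; omega)
  have f2 : |twoTrianglesPattern.gap w 2| = 3 + (w 0 : ℤ) :=
    (abs_eq (by clear * -; omega)).2 (by rw [g2]; clear * - z1 z2 z3 z4; omega)
  have f3 : |twoTrianglesPattern.gap w 3| = 3 + (w 0 : ℤ) :=
    (abs_eq (by clear * -; omega)).2 (by rw [g3]; clear * - z1 z2 z3 z4; omega)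
  have f4 : |twoTrianglesPattern.gap w 4| = 0 :=
    (abs_eq (by clear * -; omega)).2 (by rw [g4]; clear * - z1 z2 z3 z4; omega)
  have f5 : |twoTrianglesPattern.gap w 5| = 3 + (w 0 : ℤ) :=
    (abs_eq (by clear * -; omega)).2 (by rw [g5]; clear * - z1 z2 z3 z4; omega)
  rw [f0, f1, f2, f3, f4, f5]
  push_cast
  simp only [z1, z2, z3, z4]
  push_cast
  ring

/-- With m = 5 + ∑ w the two thresholds are 2m + 6 and m + 15. The first is attained with all weight
at a vertex of degree 3, the second with all weight at a vertex of degree 2. -/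
lemma diamondPattern_defect (w : Fin 4 → ℕ) :
    16 + 2 * ∑ l, (w l : ℤ) < diamondPattern.defect w ∨
      20 + ∑ l, (w l : ℤ) < diamondPattern.defect w ∨
      (diamondPattern.defect w = 16 + 2 * ∑ l, (w l : ℤ) ∧
        ((∀ l, l ≠ 0 → w l = 0) ∨ ∀ l, l ≠ 1 → w l = 0)) ∨
      (diamondPattern.defect w = 20 + ∑ l, (w l : ℤ) ∧
        ((∀ l, l ≠ 2 → w l = 0) ∨ ∀ l, l ≠ 3 → w l = 0)) := by
  obtain ⟨g0, g1, g2, g3, g4⟩ := diamondPattern_gap w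
  have hs : ∑ t, |diamondPattern.gap w t| = _ :=
    Fin.sum_univ_five fun t : Fin 5 => |diamondPattern.gap w t|
  rw [defect_eq, hs, Fin.sum_univ_four, g0, g1, g2, g3, g4]
  simp only [Fin.forall_fin_succ, abs_eq_max_neg]
  clear * -
  simp
  omega

/-! ### From a pattern inside G to the total deficiency -/

section Recognition

variable {V : Type*} [Fintype V] {G : SimpleGraph V} {m k : ℕ}

lemma BicyclicPattern.exists_weights_isom (P : BicyclicPattern k) (H : SimpleGraph (Fin k))
    (hH : ∀ i j, H.Adj i j ↔ ∃ t, s((P.edge t).1, (P.edge t).2) = s(i, j))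
    (hG : IsBicyclic G m) {ι : Fin k → V} (hι : Function.Injective ι)
    (hadj : ∀ t, G.Adj (ι (P.edge t).1) (ι (P.edge t).2)) :
    ∃ w : Fin k → ℕ, (m : ℤ) = k + 1 + ∑ l, (w l : ℤ) ∧ P.defect w ≤ totalDeficiency G ∧
      ∀ l₀, (∀ l, l ≠ l₀ → w l = 0) → totalDeficiency G = P.defect w →
        Isom G (attachPendants H l₀ (m - (k + 1))) := by
  obtain ⟨w, hm, hD, hrig, -, hcore⟩ := P.exists_weights hG hι hadj
  refine ⟨w, by exact_mod_cast hm, hD, fun l₀ hl₀ heq => ?_⟩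
  refine isom_attachPendants ι hι ?_ (fun i j => ?_) (hrig l₀ hl₀ heq)
  -- A bicyclic graph of size m has m - 1 vertices, so m - 1 - k lie outside the pattern.
  · have := hG.2.1
    have := hG.2.2
    omega
  · rw [hH]
    refine ⟨hcore i j, ?_⟩
    rintro ⟨t, ht⟩
    have := hadj t
    rcases Sym2.eq_iff.1 ht with ⟨h1, h2⟩ | ⟨h1, h2⟩ <;> rw [h1, h2] at this
    · exact this
    · exact this.symm

lemma BicyclicPattern.totalDeficiency_of_isom (P : BicyclicPattern k) {H : SimpleGraph (Fin k)}
    (hH : ∀ i j, H.Adj i j ↔ ∃ t, s((P.edge t).1, (P.edge t).2) = s(i, j))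
    (hG : IsBicyclic G m) {l₀ : Fin k} {p : ℕ} (h : Isom G (attachPendants H l₀ p)) :
    ∃ w : Fin k → ℕ, (m : ℤ) = k + 1 + ∑ l, (w l : ℤ) ∧ (∀ l, l ≠ l₀ → w l = 0) ∧
      totalDeficiency G = P.defect w := by
  obtain ⟨ι, hι, h1, h2⟩ := exists_embedding_of_isom h
  obtain ⟨w, hm, -, -, hval, -⟩ := P.exists_weights hG hι fun t =>
    (h1 _ _).2 ((hH _ _).2 ⟨t, rfl⟩)
  exact ⟨w, by exact_mod_cast hm, hval l₀ h2⟩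

lemma twoSquares_adj (i j : Fin 7) : twoSquares.Adj i j ↔
    ∃ t, s((twoSquaresPattern.edge t).1, (twoSquaresPattern.edge t).2) = s(i, j) := by
  simp only [twoSquares, fromEdgeSet_adj, Set.mem_insert_iff, Set.mem_singleton_iff]
  revert i j
  decide

lemma squareTriangle_adj (i j : Fin 6) : squareTriangle.Adj i j ↔
    ∃ t, s((squareTrianglePattern.edge t).1, (squareTrianglePattern.edge t).2) = s(i, j) := by
  simp only [squareTriangle, fromEdgeSet_adj, Set.mem_insert_iff, Set.mem_singleton_iff]
  revert i j
  decide

lemma twoTriangles_adj (i j : Fin 5) : twoTriangles.Adj i j ↔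
    ∃ t, s((twoTrianglesPattern.edge t).1, (twoTrianglesPattern.edge t).2) = s(i, j) := by
  simp only [twoTriangles, fromEdgeSet_adj, Set.mem_insert_iff, Set.mem_singleton_iff]
  revert i j
  decide

lemma diamond_adj (i j : Fin 4) : diamond.Adj i j ↔
    ∃ t, s((diamondPattern.edge t).1, (diamondPattern.edge t).2) = s(i, j) := by
  simp only [diamond, fromEdgeSet_adj, Set.mem_insert_iff, Set.mem_singleton_iff]
  revert i j
  decide

lemma thetaTwo_adj (i j : Fin 5) : thetaTwo.Adj i j ↔
    ∃ t, s((thetaTwoPattern.edge t).1, (thetaTwoPattern.edge t).2) = s(i, j) := by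
  simp only [thetaTwo, fromEdgeSet_adj, Set.mem_insert_iff, Set.mem_singleton_iff]
  revert i j
  decide

/-- The automorphism of the diamond that reverses both diagonals. -/
def diamondFlip : diamond ≃g diamond where
  toEquiv := (Equiv.swap 0 1).trans (Equiv.swap 2 3)
  map_rel_iff' := by
    intro i j
    rw [diamond_adj, diamond_adj]
    revert i j
    decide

lemma diamondPattern_defect_zero (w : Fin 4 → ℕ) (hw : ∀ l, l ≠ 0 → w l = 0) :
    diamondPattern.defect w = 16 + 2 * ∑ l, (w l : ℤ) := by
  obtain ⟨g0, g1, g2, g3, g4⟩ := diamondPattern_gap w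
  have hs : ∑ t, |diamondPattern.gap w t| = _ :=
    Fin.sum_univ_five fun t : Fin 5 => |diamondPattern.gap w t|
  rw [defect_eq, hs, Fin.sum_univ_four, g0, g1, g2, g3, g4]
  rw [hw 1 (by decide), hw 2 (by decide), hw 3 (by decide)]
  clear * -
  simp only [abs_eq_max_neg]
  push_cast
  omega

/-- Two of the gaps are 1 - w 2 up to sign, so the formula changes at weight zero. The bare diamond
belongs to the other threshold, as it must, since `B3` and `B4` coincide at size 5. -/
lemma diamondPattern_defect_two (w : Fin 4 → ℕ) (hw : ∀ l, l ≠ 2 → w l = 0) :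
    (0 < ∑ l, (w l : ℤ) → diamondPattern.defect w = 20 + ∑ l, (w l : ℤ)) ∧
      (∑ l, (w l : ℤ) = 0 → diamondPattern.defect w = 16) := by
  obtain ⟨g0, g1, g2, g3, g4⟩ := diamondPattern_gap w
  have hs : ∑ t, |diamondPattern.gap w t| = _ :=
    Fin.sum_univ_five fun t : Fin 5 => |diamondPattern.gap w t|
  rw [defect_eq, hs, Fin.sum_univ_four, g0, g1, g2, g3, g4]
  rw [hw 0 (by decide), hw 1 (by decide), hw 3 (by decide)]
  clear * -
  simp only [abs_eq_max_neg]
  push_cast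
  omega

lemma totalDeficiency_B (hG : IsBicyclic G m) (h : Isom G (B m)) : totalDeficiency G = 24 := by
  obtain ⟨w, -, hw, hD⟩ := twoSquaresPattern.totalDeficiency_of_isom twoSquares_adj hG h
  rw [hD, twoSquaresPattern_defect_eq w hw]

lemma totalDeficiency_B1 (hG : IsBicyclic G m) (h : Isom G (B1 m)) :
    totalDeficiency G = m + 15 := by
  obtain ⟨w, hm, hw, hD⟩ := squareTrianglePattern.totalDeficiency_of_isom squareTriangle_adj hG h
  rw [hD, squareTrianglePattern_defect_eq w hw, hm]
  push_cast
  ring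

lemma totalDeficiency_B2 (hG : IsBicyclic G m) (h : Isom G (B2 m)) :
    totalDeficiency G = 2 * m + 6 := by
  obtain ⟨w, hm, hw, hD⟩ := twoTrianglesPattern.totalDeficiency_of_isom twoTriangles_adj hG h
  rw [hD, twoTrianglesPattern_defect_eq w hw, hm]
  push_cast
  ring

lemma totalDeficiency_B3 (hG : IsBicyclic G m) (h : Isom G (B3 m)) :
    totalDeficiency G = 2 * m + 6 := by
  obtain ⟨w, hm, hw, hD⟩ := diamondPattern.totalDeficiency_of_isom diamond_adj hG h
  rw [hD, diamondPattern_defect_zero w hw, hm]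
  push_cast
  ring

lemma totalDeficiency_B4 (hG : IsBicyclic G m) (h : Isom G (B4 m)) :
    (5 < m → totalDeficiency G = m + 15) ∧ (m = 5 → totalDeficiency G = 16) := by
  obtain ⟨w, hm, hw, hD⟩ := diamondPattern.totalDeficiency_of_isom diamond_adj hG h
  obtain ⟨h1, h2⟩ := diamondPattern_defect_two w hw
  rw [hD]
  push_cast at hm
  refine ⟨fun h => ?_, fun h => h2 (by omega)⟩
  rw [h1 (by omega), hm]
  ring

/-- The possible positions of the total deficiency of a bicyclic graph. -/
def Outcome (G : SimpleGraph V) (m : ℕ) : Prop :=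
  24 < totalDeficiency G ∨ (m : ℤ) + 15 < totalDeficiency G ∨ 2 * (m : ℤ) + 6 < totalDeficiency G ∨
  (totalDeficiency G = 24 ∧ Isom G (B m)) ∨ (totalDeficiency G = m + 15 ∧ Isom G (B1 m)) ∨
  (totalDeficiency G = 2 * m + 6 ∧ (Isom G (B2 m) ∨ Isom G (B3 m))) ∨
  (totalDeficiency G = m + 15 ∧ Isom G (B4 m))

lemma outcome_twoSquares (hG : IsBicyclic G m) {a b c d x y z : V}
    (hab : G.Adj a b) (hbc : G.Adj b c) (hcd : G.Adj c d) (hda : G.Adj d a)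
    (hax : G.Adj a x) (hxy : G.Adj x y) (hyz : G.Adj y z) (hza : G.Adj z a)
    (hn : [a, b, c, d, x, y, z].Nodup) : Outcome G m := by
  obtain ⟨w, hm, hD, hrig⟩ := twoSquaresPattern.exists_weights_isom twoSquares twoSquares_adj hG
    (ι := ![a, b, c, d, x, y, z]) (List.nodup_ofFn.1 (by simpa using hn)) (by
      intro t; fin_cases t; exacts [hab, hbc, hcd, hda, hax, hxy, hyz, hza])
  obtain ⟨h1, h2⟩ := twoSquaresPattern_defect w
  rcases (h1.trans hD).lt_or_eq with h | h
  · exact Or.inl h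
  · have h' : twoSquaresPattern.defect w = 24 := le_antisymm (h ▸ hD) h1
    exact Or.inr (Or.inr (Or.inr (Or.inl ⟨h.symm, hrig 0 (h2 h') (h.symm.trans h'.symm)⟩)))

lemma outcome_squareTriangle (hG : IsBicyclic G m) {a b c d x y : V}
    (hab : G.Adj a b) (hbc : G.Adj b c) (hcd : G.Adj c d) (hda : G.Adj d a)
    (hax : G.Adj a x) (hxy : G.Adj x y) (hya : G.Adj y a)
    (hn : [a, b, c, d, x, y].Nodup) : Outcome G m := by
  obtain ⟨w, hm, hD, hrig⟩ := squareTrianglePattern.exists_weights_isom squareTriangle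
    squareTriangle_adj hG
    (ι := ![a, b, c, d, x, y]) (List.nodup_ofFn.1 (by simpa using hn)) (by
      intro t; fin_cases t; exacts [hab, hbc, hcd, hda, hax, hxy, hya])
  obtain ⟨h1, h2⟩ := squareTrianglePattern_defect w
  push_cast at hm
  rcases (h1.trans hD).lt_or_eq with h | h
  · exact Or.inr (Or.inl (by linarith))
  · have h' := le_antisymm (h ▸ hD) h1
    exact Or.inr (Or.inr (Or.inr (Or.inr (Or.inl
      ⟨by linarith, hrig 0 (h2 h') (h.symm.trans h'.symm)⟩))))

lemma outcome_twoTriangles (hG : IsBicyclic G m) {a b c x y : V}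
    (hab : G.Adj a b) (hbc : G.Adj b c) (hca : G.Adj c a)
    (hax : G.Adj a x) (hxy : G.Adj x y) (hya : G.Adj y a)
    (hn : [a, b, c, x, y].Nodup) : Outcome G m := by
  obtain ⟨w, hm, hD, hrig⟩ := twoTrianglesPattern.exists_weights_isom twoTriangles
    twoTriangles_adj hG
    (ι := ![a, b, c, x, y]) (List.nodup_ofFn.1 (by simpa using hn)) (by
      intro t; fin_cases t; exacts [hab, hbc, hca, hax, hxy, hya])
  obtain ⟨h1, h2⟩ := twoTrianglesPattern_defect w
  push_cast at hm
  rcases (h1.trans hD).lt_or_eq with h | h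
  · exact Or.inr (Or.inr (Or.inl (by linarith)))
  · have h' := le_antisymm (h ▸ hD) h1
    exact Or.inr (Or.inr (Or.inr (Or.inr (Or.inr (Or.inl
      ⟨by linarith, Or.inl (hrig 0 (h2 h') (h.symm.trans h'.symm))⟩)))))

lemma outcome_diamond (hG : IsBicyclic G m) {a b c d : V}
    (hab : G.Adj a b) (hac : G.Adj a c) (hcb : G.Adj c b) (had : G.Adj a d) (hdb : G.Adj d b)
    (hcd : c ≠ d) : Outcome G m := by
  have hn : [a, b, c, d].Nodup := by
    simp [hab.ne, hac.ne, hcb.ne', had.ne, hdb.ne', hcd]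
  obtain ⟨w, hm, hD, hrig⟩ := diamondPattern.exists_weights_isom diamond
    diamond_adj hG
    (ι := ![a, b, c, d]) (List.nodup_ofFn.1 (by simpa using hn)) (by
      intro t; fin_cases t; exacts [hab, hac, hcb, had, hdb])
  push_cast at hm
  rcases diamondPattern_defect w with h | h | ⟨h, h'⟩ | ⟨h, h'⟩
  · exact Or.inr (Or.inr (Or.inl (by linarith)))
  · exact Or.inr (Or.inl (by linarith))
  · rcases hD.lt_or_eq with hlt | heq
    · exact Or.inr (Or.inr (Or.inl (by linarith)))
    · refine Or.inr (Or.inr (Or.inr (Or.inr (Or.inr (Or.inl ⟨by linarith, Or.inr ?_⟩)))))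
      rcases h' with h' | h'
      · exact hrig 0 h' heq.symm
      · exact (hrig 1 h' heq.symm).trans_attachPendants diamondFlip
  · rcases hD.lt_or_eq with hlt | heq
    · exact Or.inr (Or.inl (by linarith))
    · refine Or.inr (Or.inr (Or.inr (Or.inr (Or.inr (Or.inr ⟨by linarith, ?_⟩)))))
      rcases h' with h' | h'
      · exact hrig 2 h' heq.symm
      · exact (hrig 3 h' heq.symm).trans_attachPendants diamondFlip

lemma lt_totalDeficiency_house (hG : IsBicyclic G m) {a b c x y : V}
    (hab : G.Adj a b) (hbc : G.Adj b c) (hca : G.Adj c a)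
    (hax : G.Adj a x) (hxy : G.Adj x y) (hyb : G.Adj y b)
    (hn : [a, b, c, x, y].Nodup) : (m : ℤ) + 15 < totalDeficiency G := by
  obtain ⟨w, hm, hD, -⟩ := housePattern.exists_weights hG
    (ι := ![a, b, c, x, y]) (List.nodup_ofFn.1 (by simpa using hn)) (by
      intro t; fin_cases t; exacts [hab, hbc, hca, hax, hxy, hyb])
  have h1 := housePattern_defect w
  rw [hm]
  push_cast
  linarith

lemma lt_totalDeficiency_domino (hG : IsBicyclic G m) {a b c d x y : V}
    (hab : G.Adj a b) (hbc : G.Adj b c) (hcd : G.Adj c d) (hda : G.Adj d a)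
    (hax : G.Adj a x) (hxy : G.Adj x y) (hyb : G.Adj y b)
    (hn : [a, b, c, d, x, y].Nodup) : 24 < totalDeficiency G := by
  obtain ⟨w, hm, hD, -⟩ := dominoPattern.exists_weights hG
    (ι := ![a, b, c, d, x, y]) (List.nodup_ofFn.1 (by simpa using hn)) (by
      intro t; fin_cases t; exacts [hab, hbc, hcd, hda, hax, hxy, hyb])
  have h1 := dominoPattern_defect w
  linarith

lemma lt_totalDeficiency_thetaTwoTwoThree (hG : IsBicyclic G m) {a b c d x y : V}
    (hab : G.Adj a b) (hbc : G.Adj b c) (hcd : G.Adj c d) (hda : G.Adj d a)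
    (hax : G.Adj a x) (hxy : G.Adj x y) (hyc : G.Adj y c)
    (hn : [a, b, c, d, x, y].Nodup) : 24 < totalDeficiency G := by
  obtain ⟨w, hm, hD, -⟩ := thetaTwoTwoThreePattern.exists_weights hG
    (ι := ![a, b, c, d, x, y]) (List.nodup_ofFn.1 (by simpa using hn)) (by
      intro t; fin_cases t; exacts [hab, hbc, hcd, hda, hax, hxy, hyc])
  have h1 := thetaTwoTwoThreePattern_defect w
  linarith

lemma lt_totalDeficiency_thetaTwo (hG : IsBicyclic G m) {a b x y z : V}
    (hax : G.Adj a x) (hxb : G.Adj x b) (hay : G.Adj a y) (hyb : G.Adj y b)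
    (haz : G.Adj a z) (hzb : G.Adj z b) (hn : [a, b, x, y, z].Nodup) :
    24 < totalDeficiency G ∨ m = 6 ∧ 24 ≤ totalDeficiency G := by
  obtain ⟨w, hm, hD, -⟩ := thetaTwoPattern.exists_weights hG
    (ι := ![a, b, x, y, z]) (List.nodup_ofFn.1 (by simpa using hn)) (by
      intro t; fin_cases t; exacts [hax, hxb, hay, hyb, haz, hzb])
  obtain ⟨h1, h2⟩ := thetaTwoPattern_defect w
  by_cases h : 0 < ∑ l, w l
  · have := h2 (by exact_mod_cast h)
    exact Or.inl (by linarith)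
  · exact Or.inr ⟨by omega, by linarith⟩

end Recognition

/-! ### Every bicyclic graph has one of the outcomes -/

section Bound

variable {V : Type*} {G : SimpleGraph V} {m : ℕ}

/-- An edge lying inside neither set has positive deficiency. The strictness matters: two disjoint
short cycles alone give exactly 2(m + 3), m + 15 or 24. -/
lemma add_lt_totalDeficiency [Fintype V] (hG : G.Connected) (X Y : Set V) (hXY : Disjoint X Y)
    (hX : X.Nonempty) (hY : Y.Nonempty)
    (dX : ∀ x ∈ X, ∃ a ∈ X, ∃ b ∈ X, a ≠ b ∧ G.Adj x a ∧ G.Adj x b)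
    (dY : ∀ y ∈ Y, ∃ a b, a ≠ b ∧ G.Adj y a ∧ G.Adj y b)
    (A A' : Finset (Sym2 V)) (hA : ∀ f ∈ A, f ∈ G.edgeSet) (hA' : ∀ f ∈ A', f ∈ G.edgeSet)
    (hAX : ∀ f ∈ A, ∀ v ∈ f, v ∈ X) (hAY : ∀ f ∈ A', ∀ v ∈ f, v ∈ Y) :
    ∑ f ∈ A, deficiency G f + ∑ f ∈ A', deficiency G f < totalDeficiency G := by
  classical
  obtain ⟨e, he, hpos, ⟨v, hv, hvX⟩, ⟨v', hv', hvY⟩⟩ :=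
    exists_joining_edge hG X Y hXY hX hY dX dY
  have hd : Disjoint A A' := Finset.disjoint_left.2 fun f h1 h2 => by
    induction f with | _ x y
    exact Set.disjoint_left.1 hXY (hAX _ h1 x (by simp)) (hAY _ h2 x (by simp))
  have hn : e ∉ A ∪ A' := by
    rw [Finset.mem_union]
    rintro (h | h)
    · exact hvX (hAX e h v hv)
    · exact hvY (hAY e h v' hv')
  have := sum_deficiency_le hG (insert e (A ∪ A')) (by
    intro f hf
    simp only [Finset.mem_insert, Finset.mem_union] at hf
    rcases hf with rfl | hf | hf
    · exact he
    · exact hA f hf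
    · exact hA' f hf)
  rw [Finset.sum_insert hn, Finset.sum_union hd] at this
  linarith

/-- Three pairwise adjacent vertices. -/
def IsTriangle (G : SimpleGraph V) (a b c : V) : Prop := G.Adj a b ∧ G.Adj b c ∧ G.Adj c a

/-- The vertices of a 4-cycle, in cyclic order. -/
def IsSquare (G : SimpleGraph V) (a b c d : V) : Prop :=
  G.Adj a b ∧ G.Adj b c ∧ G.Adj c d ∧ G.Adj d a ∧ a ≠ c ∧ b ≠ d

lemma IsTriangle.exists_edges [Fintype V] (hG : G.Connected) {a b c : V} (h : IsTriangle G a b c) :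
    ∃ A : Finset (Sym2 V), A.card = 3 ∧ (∀ f ∈ A, OnCycle G f) ∧
      (∀ f ∈ A, ∀ v ∈ f, v ∈ ({a, b, c} : Set V)) ∧
      edgeCount G + 3 ≤ ∑ f ∈ A, deficiency G f ∧
      ∀ u ∈ ({a, b, c} : Set V), ∀ v ∈ ({a, b, c} : Set V), u ≠ v → s(u, v) ∈ A := by
  classical
  obtain ⟨hab, hbc, hca⟩ := h
  have e1 : s(a, b) ∉ ({s(b, c), s(c, a)} : Finset (Sym2 V)) := by
    simp [hab.ne, hca.ne', hbc.ne]
  have e2 : s(b, c) ∉ ({s(c, a)} : Finset (Sym2 V)) := by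
    simp [hab.ne', hbc.ne]
  refine ⟨{s(a, b), s(b, c), s(c, a)}, ?_, ?_, ?_, ?_, ?_⟩
  · rw [Finset.card_insert_of_notMem e1, Finset.card_insert_of_notMem e2, Finset.card_singleton]
  · simp only [Finset.mem_insert, Finset.mem_singleton, forall_eq_or_imp, forall_eq]
    exact ⟨onCycle_triangle hab hbc hca, onCycle_triangle hbc hca hab, onCycle_triangle hca hab hbc⟩
  · simp
  · rw [Finset.sum_insert e1, Finset.sum_insert e2, Finset.sum_singleton, ← add_assoc]
    exact triangle_deficiency hG hab hbc hca
  · rintro u (rfl | rfl | rfl) v (rfl | rfl | rfl) huv <;> first | exact absurd rfl huv | simp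

lemma IsSquare.rotate {a b c d : V} (h : IsSquare G a b c d) : IsSquare G b c d a :=
  ⟨h.2.1, h.2.2.1, h.2.2.2.1, h.1, h.2.2.2.2.2, h.2.2.2.2.1.symm⟩

lemma IsSquare.reflect {a b c d : V} (h : IsSquare G a b c d) : IsSquare G b a d c :=
  ⟨h.1.symm, h.2.2.2.1.symm, h.2.2.1.symm, h.2.1.symm, h.2.2.2.2.2, h.2.2.2.2.1⟩

lemma IsSquare.exists_edges [Fintype V] (hG : G.Connected) {a b c d : V} (h : IsSquare G a b c d) :
    ∃ A : Finset (Sym2 V), A.card = 4 ∧ (∀ f ∈ A, OnCycle G f) ∧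
      (∀ f ∈ A, ∀ v ∈ f, v ∈ ({a, b, c, d} : Set V)) ∧
      12 ≤ ∑ f ∈ A, deficiency G f ∧ s(a, b) ∈ A ∧ s(b, c) ∈ A ∧ s(c, d) ∈ A ∧ s(d, a) ∈ A := by
  classical
  obtain ⟨hab, hbc, hcd, hda, hac, hbd⟩ := h
  have e1 : s(a, b) ∉ ({s(b, c), s(c, d), s(d, a)} : Finset (Sym2 V)) := by
    simp [hab.ne, hac, hbc.ne, hbd, hda.ne']
  have e2 : s(b, c) ∉ ({s(c, d), s(d, a)} : Finset (Sym2 V)) := by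
    simp [hbc.ne, hbd, hab.ne']
  have e3 : s(c, d) ∉ ({s(d, a)} : Finset (Sym2 V)) := by
    simp [hac.symm, hcd.ne]
  refine ⟨{s(a, b), s(b, c), s(c, d), s(d, a)}, ?_, ?_, ?_, ?_, by simp, by simp, by simp, by simp⟩
  · rw [Finset.card_insert_of_notMem e1, Finset.card_insert_of_notMem e2,
      Finset.card_insert_of_notMem e3, Finset.card_singleton]
  · simp only [Finset.mem_insert, Finset.mem_singleton, forall_eq_or_imp, forall_eq]
    exact ⟨onCycle_square hab hbc hcd hda hac hbd, onCycle_square hbc hcd hda hab hbd hac.symm,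
      onCycle_square hcd hda hab hbc hac.symm hbd.symm,
      onCycle_square hda hab hbc hcd hbd.symm hac⟩
  · simp
  · rw [Finset.sum_insert e1, Finset.sum_insert e2, Finset.sum_insert e3, Finset.sum_singleton]
    have := square_deficiency hG hab hbc hcd hda hac hbd
    have := square_deficiency hG hbc hcd hda hab hbd hac.symm
    have := square_deficiency hG hcd hda hab hbc hac.symm hbd.symm
    have := square_deficiency hG hda hab hbc hcd hbd.symm hac
    linarith

lemma IsTriangle.exists_nbrs {a b c : V} (h : IsTriangle G a b c) :
    ∀ x ∈ ({a, b, c} : Set V), ∃ p ∈ ({a, b, c} : Set V), ∃ q ∈ ({a, b, c} : Set V),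
      p ≠ q ∧ G.Adj x p ∧ G.Adj x q := by
  obtain ⟨hab, hbc, hca⟩ := h
  rintro x (rfl | rfl | rfl)
  · exact ⟨b, by simp, c, by simp, hbc.ne, hab, hca.symm⟩
  · exact ⟨a, by simp, c, by simp, hca.ne', hab.symm, hbc⟩
  · exact ⟨a, by simp, b, by simp, hab.ne, hca, hbc.symm⟩

lemma IsSquare.exists_nbrs {a b c d : V} (h : IsSquare G a b c d) :
    ∀ x ∈ ({a, b, c, d} : Set V), ∃ p ∈ ({a, b, c, d} : Set V), ∃ q ∈ ({a, b, c, d} : Set V),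
      p ≠ q ∧ G.Adj x p ∧ G.Adj x q := by
  obtain ⟨hab, hbc, hcd, hda, hac, hbd⟩ := h
  rintro x (rfl | rfl | rfl | rfl)
  · exact ⟨b, by simp, d, by simp, hbd, hab, hda.symm⟩
  · exact ⟨a, by simp, c, by simp, hac, hab.symm, hbc⟩
  · exact ⟨b, by simp, d, by simp, hbd, hbc.symm, hcd⟩
  · exact ⟨a, by simp, c, by simp, hac, hda, hcd.symm⟩

lemma IsTriangle.exists_third {a b c : V} (h : IsTriangle G a b c) :
    ∀ p ∈ ({a, b, c} : Set V), ∀ q ∈ ({a, b, c} : Set V), p ≠ q →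
      ∃ r ∈ ({a, b, c} : Set V), IsTriangle G p q r := by
  obtain ⟨hab, hbc, hca⟩ := h
  rintro p (rfl | rfl | rfl) q (rfl | rfl | rfl) hpq
  · exact absurd rfl hpq
  · exact ⟨c, by simp, hab, hbc, hca⟩
  · exact ⟨b, by simp, hca.symm, hbc.symm, hab.symm⟩
  · exact ⟨c, by simp, hab.symm, hca.symm, hbc.symm⟩
  · exact absurd rfl hpq
  · exact ⟨a, by simp, hbc, hca, hab⟩
  · exact ⟨b, by simp, hca, hab, hbc⟩
  · exact ⟨a, by simp, hbc.symm, hab.symm, hca.symm⟩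
  · exact absurd rfl hpq

lemma IsSquare.exists_others {a b c d : V} (h : IsSquare G a b c d) :
    ∀ p ∈ ({a, b, c, d} : Set V), ∀ q ∈ ({a, b, c, d} : Set V), p ≠ q →
      (∃ r ∈ ({a, b, c, d} : Set V), ∃ s ∈ ({a, b, c, d} : Set V), IsSquare G p q r s) ∨
      (∃ r ∈ ({a, b, c, d} : Set V), ∃ s ∈ ({a, b, c, d} : Set V), IsSquare G p r q s) := by
  have h1 := h.rotate
  have h2 := h1.rotate
  have h3 := h2.rotate
  rintro p (rfl | rfl | rfl | rfl) q (rfl | rfl | rfl | rfl) hpq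
  · exact absurd rfl hpq
  · exact Or.inl ⟨c, by simp, d, by simp, h⟩
  · exact Or.inr ⟨b, by simp, d, by simp, h⟩
  · exact Or.inl ⟨c, by simp, b, by simp, h3.reflect⟩
  · exact Or.inl ⟨d, by simp, c, by simp, h.reflect⟩
  · exact absurd rfl hpq
  · exact Or.inl ⟨d, by simp, a, by simp, h1⟩
  · exact Or.inr ⟨c, by simp, a, by simp, h1⟩
  · exact Or.inr ⟨d, by simp, b, by simp, h2⟩
  · exact Or.inl ⟨a, by simp, d, by simp, h1.reflect⟩
  · exact absurd rfl hpq
  · exact Or.inl ⟨a, by simp, b, by simp, h2⟩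
  · exact Or.inl ⟨b, by simp, c, by simp, h3⟩
  · exact Or.inr ⟨a, by simp, c, by simp, h3⟩
  · exact Or.inl ⟨b, by simp, a, by simp, h2.reflect⟩
  · exact absurd rfl hpq

/-- Every configuration that `exists_four_far_edges` forbids leads to an outcome by itself: a
disjoint short cycle by addition, a short cycle through one vertex or a short ear by its pattern. If
none occurs, the four far edges decide. -/
lemma IsBicyclic.outcome_of_triangle [Fintype V] (hG : IsBicyclic G m) {a b c : V} (h : IsTriangle G a b c) :
    Outcome G m := by
  classical
  obtain ⟨A, cA, onA, AX, dA, memA⟩ := h.exists_edges hG.1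
  have third := h.exists_third
  have nbrs := h.exists_nbrs
  have haX : a ∈ ({a, b, c} : Set V) := by simp
  generalize ({a, b, c} : Set V) = X at *
  rw [hG.edgeCount_eq] at dA
  by_contra hno
  have ne_of : ∀ {p x : V}, p ∈ X → x ∉ X → p ≠ x := fun hp hx h => hx (h ▸ hp)
  have exists_tri : ∀ p ∈ X, ∃ q ∈ X, ∃ r ∈ X, IsTriangle G p q r := by
    intro p hp
    obtain ⟨q, hq, -, -, -, hpq, -⟩ := nbrs p hp
    obtain ⟨r, hr, ht⟩ := third p hp q hq hpq.ne
    exact ⟨q, hq, r, hr, ht⟩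
  obtain ⟨K, -, hK, hKX, dK⟩ := exists_four_far_edges hG.1 X
    (by
      intro x y z hx hy hz hxy hyz hzx
      have ht : IsTriangle G x y z := ⟨hxy, hyz, hzx⟩
      obtain ⟨A', -, onA', AX', dA', -⟩ := ht.exists_edges hG.1
      have := add_lt_totalDeficiency hG.1 X {x, y, z}
        (Set.disjoint_left.2 (by rintro v hv (rfl | rfl | rfl) <;> contradiction))
        ⟨a, haX⟩ ⟨x, by simp⟩ nbrs
        (fun v hv => by
          obtain ⟨p, -, q, -, h⟩ := ht.exists_nbrs v hv
          exact ⟨p, q, h⟩) A A'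
        (fun f hf => (onA f hf).mem_edgeSet) (fun f hf => (onA' f hf).mem_edgeSet) AX AX'
      rw [hG.edgeCount_eq] at dA'
      exact hno (Or.inr (Or.inr (Or.inl (by linarith)))))
    (by
      intro p y z hp hy hz hpy hyz hzp
      obtain ⟨q, hq, r, hr, ht⟩ := exists_tri p hp
      exact hno (outcome_twoTriangles hG ht.1 ht.2.1 ht.2.2 hpy hyz hzp (by
        simp [ht.1.ne, ht.2.1.ne, ht.2.2.ne', hpy.ne, hyz.ne, hzp.ne', ne_of hq hy, ne_of hq hz,
          ne_of hr hy, ne_of hr hz])))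
    (by
      intro p x q hp hq hx hpq hpx hxq
      obtain ⟨r, hr, ht⟩ := third p hp q hq hpq
      exact hno (outcome_diamond hG ht.1 ht.2.2.symm ht.2.1.symm hpx hxq (ne_of hr hx)))
    (by
      intro p x y q hp hq hx hy hpq hpx hxy hyq
      obtain ⟨r, hr, ht⟩ := third p hp q hq hpq
      exact hno (Or.inr (Or.inl (lt_totalDeficiency_house hG ht.1 ht.2.1 ht.2.2 hpx hxy hyq (by
        simp [ht.1.ne, ht.2.1.ne, ht.2.2.ne', hpx.ne, hxy.ne, hyq.ne', ne_of hp hy, ne_of hq hx,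
          ne_of hr hy, ne_of hr hx])))))
    (by
      intro x y z t hx hy hz ht hxz hyt hxy hyz hzt htx
      have hs : IsSquare G x y z t := ⟨hxy, hyz, hzt, htx, hxz, hyt⟩
      obtain ⟨A', -, onA', AX', dA', -⟩ := hs.exists_edges hG.1
      have := add_lt_totalDeficiency hG.1 X {x, y, z, t}
        (Set.disjoint_left.2 (by rintro v hv (rfl | rfl | rfl | rfl) <;> contradiction))
        ⟨a, haX⟩ ⟨x, by simp⟩ nbrs
        (fun v hv => by
          obtain ⟨p, -, q, -, h⟩ := hs.exists_nbrs v hv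
          exact ⟨p, q, h⟩) A A'
        (fun f hf => (onA f hf).mem_edgeSet) (fun f hf => (onA' f hf).mem_edgeSet) AX AX'
      exact hno (Or.inr (Or.inl (by linarith))))
    (by
      intro p y z t hp hy hz ht hyt hpy hyz hzt htp
      obtain ⟨q, hq, r, hr, htri⟩ := exists_tri p hp
      exact hno (outcome_squareTriangle hG hpy hyz hzt htp htri.1 htri.2.1 htri.2.2 (by
        simp [htri.1.ne, htri.2.1.ne, htri.2.2.ne', hpy.ne, hyz.ne, hzt.ne, htp.ne', hyt,
          ne_of hp hz, (ne_of hq hy).symm, (ne_of hq hz).symm, (ne_of hq ht).symm,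
          (ne_of hr hy).symm, (ne_of hr hz).symm, (ne_of hr ht).symm])))
    (by
      have hne : A.Nonempty := Finset.card_pos.1 (by omega)
      obtain ⟨e, he, heA⟩ := hG.exists_onCycle_notMem A (hne.imp fun f hf => ⟨hf, onA f hf⟩)
        fun u c hc => cA ▸ hc.three_le_length
      induction e with | _ u v
      by_cases hv : v ∈ X
      · by_cases hu : u ∈ X
        · exact absurd (memA u hu v hv he.adj.ne) heA
        · exact ⟨v, u, he.symm, hu⟩
      · exact ⟨u, v, he, hv⟩)
  have hd : Disjoint A K := Finset.disjoint_left.2 fun f h1 h2 => by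
    obtain ⟨v, hv, hvX⟩ := hKX f h2
    exact hvX (AX f h1 v hv)
  have := sum_deficiency_le hG.1 (A ∪ K) (by
    intro f hf
    rcases Finset.mem_union.1 hf with hf | hf
    · exact (onA f hf).mem_edgeSet
    · exact hK f hf)
  rw [Finset.sum_union hd] at this
  -- The triangle and the four far edges cost (m + 3) + 16.
  exact hno (Or.inr (Or.inl (by linarith)))

/-- Same dichotomy as for a triangle. Ears now depend on whether their ends are adjacent or opposite
on the square, and triangle-freeness removes the remaining triangle configurations. -/
lemma IsBicyclic.outcome_of_square [Fintype V] (hG : IsBicyclic G m)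
    (h3 : ∀ a b c, G.Adj a b → G.Adj b c → ¬ G.Adj c a) {a b c d : V} (h : IsSquare G a b c d) :
    Outcome G m := by
  classical
  obtain ⟨A, cA, onA, AX, dA, m1, m2, m3, m4⟩ := h.exists_edges hG.1
  -- A diagonal would create a triangle, so the square is induced.
  have memA : ∀ u ∈ ({a, b, c, d} : Set V), ∀ v ∈ ({a, b, c, d} : Set V), G.Adj u v →
      s(u, v) ∈ A := by
    have k1 := h3 _ _ _ h.1 h.2.1
    have k2 := h3 _ _ _ h.2.1 h.2.2.1
    have m1' := m1
    have m2' := m2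
    have m3' := m3
    have m4' := m4
    rw [Sym2.eq_swap] at m1' m2' m3' m4'
    rintro u (rfl | rfl | rfl | rfl) v (rfl | rfl | rfl | rfl) huv <;>
      first | assumption | exact absurd rfl huv.ne | exact absurd huv ‹_› | exact absurd huv.symm ‹_›
  have others := h.exists_others
  have nbrs := h.exists_nbrs
  have haX : a ∈ ({a, b, c, d} : Set V) := by simp
  generalize ({a, b, c, d} : Set V) = X at *
  by_contra hno
  have ne_of : ∀ {p x : V}, p ∈ X → x ∉ X → p ≠ x := fun hp hx h => hx (h ▸ hp)
  have exists_sq : ∀ p ∈ X, ∃ q ∈ X, ∃ r ∈ X, ∃ s ∈ X, IsSquare G p q r s := by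
    intro p hp
    obtain ⟨q, hq, -, -, -, hpq, -⟩ := nbrs p hp
    rcases others p hp q hq hpq.ne with ⟨r, hr, s, hs, h⟩ | ⟨r, hr, s, hs, h⟩
    · exact ⟨q, hq, r, hr, s, hs, h⟩
    · exact ⟨r, hr, q, hq, s, hs, h⟩
  obtain ⟨K, -, hK, hKX, dK⟩ := exists_four_far_edges hG.1 X
    (fun x y z _ _ _ hxy hyz => h3 x y z hxy hyz)
    (fun x y z _ _ _ hxy hyz => h3 x y z hxy hyz)
    (by
      intro p x q hp hq hx hpq hpx hxq
      rcases others p hp q hq hpq with ⟨r, hr, s, hs, h⟩ | ⟨r, hr, s, hs, h⟩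
      · exact h3 _ _ _ hpx hxq h.1.symm
      · obtain ⟨i1, i2, i3, i4, i5, i6⟩ := h
        have := lt_totalDeficiency_thetaTwo hG i1 i2 i4.symm i3.symm hpx hxq (by
          simp [i1.ne, i2.ne', i3.ne, i4.ne', i5, i6, ne_of hp hx, ne_of hq hx, ne_of hr hx,
            ne_of hs hx])
        rcases this with h | ⟨rfl, h⟩
        · exact hno (Or.inl h)
        -- The bare K_{2,3} has m = 6, and its cost of at least 24 exceeds 2m + 6 = 18.
        · exact hno (Or.inr (Or.inr (Or.inl (by push_cast; linarith)))))
    (by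
      intro p x y q hp hq hx hy hpq hpx hxy hyq
      rcases others p hp q hq hpq with ⟨r, hr, s, hs, h⟩ | ⟨r, hr, s, hs, h⟩ <;>
      obtain ⟨i1, i2, i3, i4, i5, i6⟩ := h
      · exact hno (Or.inl (lt_totalDeficiency_domino hG i1 i2 i3 i4 hpx hxy hyq (by
          simp [i1.ne, i2.ne, i3.ne, i4.ne', i5, i6, hxy.ne, ne_of hp hx, ne_of hq hx, ne_of hr hx,
            ne_of hs hx, ne_of hp hy, ne_of hq hy, ne_of hr hy, ne_of hs hy])))
      · exact hno (Or.inl (lt_totalDeficiency_thetaTwoTwoThree hG i1 i2 i3 i4 hpx hxy hyq (by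
          simp [i1.ne, i2.ne, i3.ne, i4.ne', i5, i6, hxy.ne, ne_of hp hx, ne_of hq hx, ne_of hr hx,
            ne_of hs hx, ne_of hp hy, ne_of hq hy, ne_of hr hy, ne_of hs hy]))))
    (by
      intro x y z t hx hy hz ht hxz hyt hxy hyz hzt htx
      have hs : IsSquare G x y z t := ⟨hxy, hyz, hzt, htx, hxz, hyt⟩
      obtain ⟨A', -, onA', AX', dA', -⟩ := hs.exists_edges hG.1
      have := add_lt_totalDeficiency hG.1 X {x, y, z, t}
        (Set.disjoint_left.2 (by rintro v hv (rfl | rfl | rfl | rfl) <;> contradiction))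
        ⟨a, haX⟩ ⟨x, by simp⟩ nbrs
        (fun v hv => by
          obtain ⟨p, -, q, -, h⟩ := hs.exists_nbrs v hv
          exact ⟨p, q, h⟩) A A'
        (fun f hf => (onA f hf).mem_edgeSet) (fun f hf => (onA' f hf).mem_edgeSet) AX AX'
      exact hno (Or.inl (by linarith)))
    (by
      intro p y z t hp hy hz ht hyt hpy hyz hzt htp
      obtain ⟨q, hq, r, hr, s, hs, i1, i2, i3, i4, i5, i6⟩ := exists_sq p hp
      exact hno (outcome_twoSquares hG i1 i2 i3 i4 hpy hyz hzt htp (by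
        simp [i1.ne, i2.ne, i3.ne, i4.ne', i5, i6, hyz.ne, hzt.ne, hyt, ne_of hp hy, ne_of hp hz,
          ne_of hp ht, ne_of hq hy, ne_of hq hz, ne_of hq ht, ne_of hr hy, ne_of hr hz,
          ne_of hr ht, ne_of hs hy, ne_of hs hz, ne_of hs ht])))
    (by
      have hne : A.Nonempty := Finset.card_pos.1 (by omega)
      obtain ⟨e, he, heA⟩ := hG.exists_onCycle_notMem A (hne.imp fun f hf => ⟨hf, onA f hf⟩)
        fun u c hc => cA ▸ four_le_length hc h3
      induction e with | _ u v
      by_cases hv : v ∈ X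
      · by_cases hu : u ∈ X
        · exact absurd (memA u hu v hv he.adj) heA
        · exact ⟨v, u, he.symm, hu⟩
      · exact ⟨u, v, he, hv⟩)
  have hd : Disjoint A K := Finset.disjoint_left.2 fun f h1 h2 => by
    obtain ⟨v, hv, hvX⟩ := hKX f h2
    exact hvX (AX f h1 v hv)
  have := sum_deficiency_le hG.1 (A ∪ K) (by
    intro f hf
    rcases Finset.mem_union.1 hf with hf | hf
    · exact (onA f hf).mem_edgeSet
    · exact hK f hf)
  rw [Finset.sum_union hd] at this
  -- The square and the four far edges cost 12 + 16.
  exact hno (Or.inl (by linarith))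

theorem IsBicyclic.outcome [Fintype V] (hG : IsBicyclic G m) : Outcome G m := by
  by_cases h3 : ∀ a b c, G.Adj a b → G.Adj b c → ¬ G.Adj c a
  · by_cases h4 : ∀ a b c d, a ≠ c → b ≠ d → G.Adj a b → G.Adj b c → G.Adj c d → ¬ G.Adj d a
    · exact Or.inl (by linarith [hG.deficiency_of_large_girth h3 h4])
    · push Not at h4
      obtain ⟨a, b, c, d, hac, hbd, hab, hbc, hcd, hda⟩ := h4
      exact hG.outcome_of_square h3 ⟨hab, hbc, hcd, hda, hac, hbd⟩
  · push Not at h3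
    obtain ⟨a, b, c, hab, hbc, hca⟩ := h3
    exact hG.outcome_of_triangle ⟨hab, hbc, hca⟩

end Bound

/-! ### The extremal graphs are bicyclic -/

section Existence

lemma BicyclicPattern.isBicyclic_attachPendants {k : ℕ} (P : BicyclicPattern k)
    {H : SimpleGraph (Fin k)}
    (hH : ∀ i j, H.Adj i j ↔ ∃ t, s((P.edge t).1, (P.edge t).2) = s(i, j)) (l₀ : Fin k) (p : ℕ) :
    IsBicyclic (attachPendants H l₀ p) (k + 1 + p) := by
  classical
  -- Connectedness of the pattern follows by descending along `d` towards `l₀`.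
  have hcore : ∀ n i, P.d i l₀ = n → (attachPendants H l₀ p).Reachable (.inl i) (.inl l₀) := by
    intro n
    induction n with
    | zero =>
      intro i hi
      rcases P.d_step i l₀ with rfl | ⟨t, ht | ht⟩
      · exact Reachable.refl _
      · omega
      · omega
    | succ n ih =>
      intro i hi
      rcases P.d_step i l₀ with rfl | ⟨t, ⟨rfl, ht⟩ | ⟨rfl, ht⟩⟩
      · exact Reachable.refl _
      · refine Reachable.trans (Adj.reachable ?_) (ih (P.edge t).2 (by omega))
        exact (hH _ _).2 ⟨t, rfl⟩
      · refine Reachable.trans (Adj.reachable ?_) (ih (P.edge t).1 (by omega))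
        exact (hH _ _).2 ⟨t, Sym2.eq_swap⟩
  have hconn : (attachPendants H l₀ p).Connected := by
    rw [connected_iff_exists_forall_reachable]
    refine ⟨.inl l₀, ?_⟩
    rintro (i | i)
    · exact (hcore _ i rfl).symm
    · exact Adj.reachable rfl
  have hedge : (attachPendants H l₀ p).edgeSet =
      ↑(P.edges (Sum.inl : Fin k → Fin k ⊕ Fin p)) ∪
        Set.range fun i : Fin p => (s(.inl l₀, .inr i) : Sym2 (Fin k ⊕ Fin p)) := by
    ext e
    induction e with | _ x y
    simp only [mem_edgeSet, BicyclicPattern.edges, coe_image, coe_univ, Set.image_univ,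
      Set.mem_union, Set.mem_range]
    rcases x with i | i <;> rcases y with j | j
    · refine ((hH i j).trans ?_)
      simp [Prod.ext_iff]
    · simp [attachPendants]
      exact eq_comm
    · simp [attachPendants]
      exact eq_comm
    · simp [attachPendants]
  have hcard : (attachPendants H l₀ p).edgeSet.ncard = k + 1 + p := by
    have hd : Disjoint (↑(P.edges (Sum.inl : Fin k → Fin k ⊕ Fin p)) : Set (Sym2 (Fin k ⊕ Fin p)))
        (Set.range fun i : Fin p => (s(.inl l₀, .inr i) : Sym2 (Fin k ⊕ Fin p))) := by
      rw [Set.disjoint_left]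
      rintro e he ⟨i, rfl⟩
      simp [BicyclicPattern.edges] at he
    rw [hedge, Set.ncard_union_eq hd (Set.toFinite _) (Set.toFinite _), Set.ncard_coe_finset,
      P.card_edges Sum.inl_injective, ← Set.image_univ, Set.ncard_image_of_injective _ fun i j hij => by simpa using hij]
    simp
  refine ⟨hconn, ?_, hcard⟩
  rw [hcard]
  simp
  omega

lemma isBicyclic_B {m : ℕ} (hm : 8 ≤ m) : IsBicyclic (B m) m := by
  have := twoSquaresPattern.isBicyclic_attachPendants twoSquares_adj 0 (m - 8)
  rwa [show 7 + 1 + (m - 8) = m by omega] at this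

lemma isBicyclic_B5 {m : ℕ} (hm : 6 ≤ m) : IsBicyclic (B5 m) m := by
  have := thetaTwoPattern.isBicyclic_attachPendants thetaTwo_adj 2 (m - 6)
  rwa [show 5 + 1 + (m - 6) = m by omega] at this

lemma IsBicyclic.of_iso {V W : Type*} [Fintype V] [Fintype W] {G : SimpleGraph V}
    {H : SimpleGraph W} {m : ℕ} (hG : IsBicyclic G m) (e : G ≃g H) : IsBicyclic H m := by
  have hc : G.edgeSet.ncard = H.edgeSet.ncard :=
    Set.ncard_congr' e.mapEdgeSet
  refine ⟨e.connected_iff.1 hG.1, ?_, hc ▸ hG.2.2⟩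
  rw [← hc, hG.2.1, Fintype.card_congr e.toEquiv]

end Existence

/-! ### The four ranges of m and the refutation of the conjecture -/

section Values

variable {V : Type*} [Fintype V] {G : SimpleGraph V} {m : ℕ}

lemma IsBicyclic.edgeMostar_eq (hG : IsBicyclic G m) :
    edgeMostar G = (m : ℤ) ^ 2 - m - totalDeficiency G := by
  rw [EdgeMostar.edgeMostar_eq, hG.edgeCount_eq]
  ring

theorem IsBicyclic.edgeMostar_five (hG : IsBicyclic G m) (hm : m = 5) :
    edgeMostar G ≤ 4 ∧ (edgeMostar G = 4 ↔ Isom G (B3 m) ∨ Isom G (B4 m)) := by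
  have h3 := fun h => totalDeficiency_B3 hG h
  have h4 := fun h => (totalDeficiency_B4 hG h).2 hm
  -- At m = 5 the truncated subtraction makes `B2 m` the bare pair of triangles, which has six
  -- edges.
  have h2 : ¬ Isom G (B2 m) := by
    intro h
    obtain ⟨w, hw, -⟩ := twoTrianglesPattern.totalDeficiency_of_isom twoTriangles_adj hG h
    push_cast at hw
    have : 0 ≤ ∑ l, (w l : ℤ) := Finset.sum_nonneg fun _ _ => by positivity
    omega
  rw [hG.edgeMostar_eq]
  subst hm
  push_cast at *
  rcases hG.outcome with h | h | h | ⟨h, -⟩ | ⟨h, -⟩ | ⟨h, h' | h'⟩ | ⟨h, -⟩ <;> push_cast at h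
  · refine ⟨by linarith, fun h => by linarith, ?_⟩
    rintro (h | h)
    · linarith [h3 h]
    · linarith [h4 h]
  · refine ⟨by linarith, fun h => by linarith, ?_⟩
    rintro (h | h)
    · linarith [h3 h]
    · linarith [h4 h]
  · refine ⟨by linarith, fun h => by linarith, ?_⟩
    rintro (h | h)
    · linarith [h3 h]
    · linarith [h4 h]
  · refine ⟨by linarith, fun h => by linarith, ?_⟩
    rintro (h | h)
    · linarith [h3 h]
    · linarith [h4 h]
  · refine ⟨by linarith, fun h => by linarith, ?_⟩
    rintro (h | h)
    · linarith [h3 h]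
    · linarith [h4 h]
  · exact absurd h' h2
  · exact ⟨by linarith, fun _ => Or.inl h', fun _ => by linarith⟩
  · refine ⟨by linarith, fun h => by linarith, ?_⟩
    rintro (h | h)
    · linarith [h3 h]
    · linarith [h4 h]

theorem IsBicyclic.edgeMostar_six_to_eight (hG : IsBicyclic G m) (_ : 6 ≤ m) (hm' : m ≤ 8) :
    edgeMostar G ≤ (m : ℤ) ^ 2 - 3 * m - 6 ∧
      (edgeMostar G = (m : ℤ) ^ 2 - 3 * m - 6 ↔ Isom G (B2 m) ∨ Isom G (B3 m)) := by
  have h2 := fun h => totalDeficiency_B2 hG h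
  have h3 := fun h => totalDeficiency_B3 hG h
  have a1 : (m : ℤ) ≤ 8 := by exact_mod_cast hm'
  rw [hG.edgeMostar_eq]
  have strict : 2 * (m : ℤ) + 6 < totalDeficiency G →
      (m : ℤ) ^ 2 - m - totalDeficiency G ≤ (m : ℤ) ^ 2 - 3 * m - 6 ∧
      ((m : ℤ) ^ 2 - m - totalDeficiency G = (m : ℤ) ^ 2 - 3 * m - 6 ↔
        Isom G (B2 m) ∨ Isom G (B3 m)) := by
    refine fun h => ⟨by linarith, fun h => by linarith, ?_⟩
    rintro (h | h)
    · linarith [h2 h]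
    · linarith [h3 h]
  rcases hG.outcome with h | h | h | ⟨h, -⟩ | ⟨h, -⟩ | ⟨h, h'⟩ | ⟨h, -⟩
  · exact strict (by linarith)
  · exact strict (by linarith)
  · exact strict (by linarith)
  · exact strict (by linarith)
  · exact strict (by linarith)
  · exact ⟨by linarith, fun _ => h', fun _ => by linarith⟩
  · exact strict (by linarith)

theorem IsBicyclic.edgeMostar_nine (hG : IsBicyclic G m) (hm : m = 9) :
    edgeMostar G ≤ 48 ∧ (edgeMostar G = 48 ↔
      Isom G (B m) ∨ Isom G (B1 m) ∨ Isom G (B2 m) ∨ Isom G (B3 m) ∨ Isom G (B4 m)) := by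
  have a1 : (m : ℤ) = 9 := by exact_mod_cast hm
  have back : Isom G (B m) ∨ Isom G (B1 m) ∨ Isom G (B2 m) ∨ Isom G (B3 m) ∨ Isom G (B4 m) →
      totalDeficiency G = 24 := by
    rintro (h | h | h | h | h)
    · exact totalDeficiency_B hG h
    · linarith [totalDeficiency_B1 hG h]
    · linarith [totalDeficiency_B2 hG h]
    · linarith [totalDeficiency_B3 hG h]
    · linarith [(totalDeficiency_B4 hG h).1 (by omega)]
  rw [hG.edgeMostar_eq, a1]
  suffices h : 24 ≤ totalDeficiency G ∧ (totalDeficiency G = 24 →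
      Isom G (B m) ∨ Isom G (B1 m) ∨ Isom G (B2 m) ∨ Isom G (B3 m) ∨ Isom G (B4 m)) from
    ⟨by linarith [h.1], fun h' => h.2 (by linarith), fun h' => by linarith [back h']⟩
  rcases hG.outcome with h | h | h | ⟨h, h'⟩ | ⟨h, h'⟩ | ⟨h, h' | h'⟩ | ⟨h, h'⟩ <;>
    refine ⟨by linarith, fun h24 => ?_⟩
  · exact absurd h24 h.ne'
  · exact absurd h24 (by linarith)
  · exact absurd h24 (by linarith)
  · exact Or.inl h'
  · exact Or.inr (Or.inl h')
  · exact Or.inr (Or.inr (Or.inl h'))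
  · exact Or.inr (Or.inr (Or.inr (Or.inl h')))
  · exact Or.inr (Or.inr (Or.inr (Or.inr h')))

/-- From m = 10 on both m + 15 and 2m + 6 exceed 24, so only the outcome with two squares can attain
the bound. -/
theorem IsBicyclic.edgeMostar_ge_ten (hG : IsBicyclic G m) (hm : 10 ≤ m) :
    edgeMostar G ≤ (m : ℤ) ^ 2 - m - 24 ∧
      (edgeMostar G = (m : ℤ) ^ 2 - m - 24 ↔ Isom G (B m)) := by
  have a1 : (10 : ℤ) ≤ m := by exact_mod_cast hm
  rw [hG.edgeMostar_eq]
  suffices h : 24 ≤ totalDeficiency G ∧ (totalDeficiency G = 24 → Isom G (B m)) from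
    ⟨by linarith [h.1], fun h' => h.2 (by linarith),
      fun h' => by linarith [totalDeficiency_B hG h']⟩
  rcases hG.outcome with h | h | h | ⟨h, h'⟩ | ⟨h, -⟩ | ⟨h, -⟩ | ⟨h, -⟩ <;>
    refine ⟨by linarith, fun h24 => ?_⟩
  · exact absurd h24 h.ne'
  · linarith
  · linarith
  · exact h'
  · linarith
  · linarith
  · linarith

lemma isMaximizer_B (hm : 10 ≤ m) : IsMaximizer (B m) m := by
  refine ⟨isBicyclic_B (by omega), fun n G hG => ?_⟩
  rw [((isBicyclic_B (m := m) (by omega)).edgeMostar_ge_ten hm).2.2 ⟨Iso.refl⟩]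
  exact (hG.edgeMostar_ge_ten hm).1

lemma edgeMostar_B5_lt (hm : 10 ≤ m) : edgeMostar (B5 m) < (m : ℤ) ^ 2 - m - 24 := by
  have hB := isBicyclic_B5 (m := m) (by omega)
  obtain ⟨w, hw, -, hD⟩ :=
    thetaTwoPattern.totalDeficiency_of_isom thetaTwo_adj hB (l₀ := 2) (p := m - 6) ⟨Iso.refl⟩
  push_cast at hw
  rw [hB.edgeMostar_eq, hD]
  linarith [(thetaTwoPattern_defect w).2 (by omega)]

lemma not_isMaximizer_B5 (hm : 10 ≤ m) : ¬ IsMaximizer (B5 m) m := by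
  rintro ⟨-, h⟩
  let e := Fintype.equivFin (Fin 7 ⊕ Fin (m - 8))
  -- Competitors in `IsMaximizer` live on `Fin n`, so `B m` is transported there first.
  let φ : B m ≃g (B m).map e.toEmbedding := SimpleGraph.Iso.map e (B m)
  have hG := (isBicyclic_B (m := m) (by omega)).of_iso φ
  have h1 := h _ _ hG
  rw [(hG.edgeMostar_ge_ten hm).2.2 ⟨φ.symm⟩] at h1
  linarith [edgeMostar_B5_lt hm]

end Values

end EdgeMostar

theorem theorem1 :
    (∀ (V : Type*) [Fintype V] (G : SimpleGraph V) (m : ℕ), 5 ≤ m → EdgeMostar.IsBicyclic G m →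
      (m = 5 →
        EdgeMostar.edgeMostar G ≤ 4 ∧
        (EdgeMostar.edgeMostar G = 4 ↔
          EdgeMostar.Isom G (EdgeMostar.B3 m) ∨ EdgeMostar.Isom G (EdgeMostar.B4 m))) ∧
      (6 ≤ m → m ≤ 8 →
        EdgeMostar.edgeMostar G ≤ (m : ℤ) ^ 2 - 3 * (m : ℤ) - 6 ∧
        (EdgeMostar.edgeMostar G = (m : ℤ) ^ 2 - 3 * (m : ℤ) - 6 ↔
          EdgeMostar.Isom G (EdgeMostar.B2 m) ∨ EdgeMostar.Isom G (EdgeMostar.B3 m))) ∧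
      (m = 9 →
        EdgeMostar.edgeMostar G ≤ 48 ∧
        (EdgeMostar.edgeMostar G = 48 ↔
          EdgeMostar.Isom G (EdgeMostar.B m) ∨ EdgeMostar.Isom G (EdgeMostar.B1 m) ∨
          EdgeMostar.Isom G (EdgeMostar.B2 m) ∨ EdgeMostar.Isom G (EdgeMostar.B3 m) ∨
          EdgeMostar.Isom G (EdgeMostar.B4 m))) ∧
      (10 ≤ m →
        EdgeMostar.edgeMostar G ≤ (m : ℤ) ^ 2 - (m : ℤ) - 24 ∧
        (EdgeMostar.edgeMostar G = (m : ℤ) ^ 2 - (m : ℤ) - 24 ↔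
          EdgeMostar.Isom G (EdgeMostar.B m)))) ∧
    (∀ m : ℕ, 10 ≤ m →
      EdgeMostar.IsMaximizer (EdgeMostar.B m) m ∧
      EdgeMostar.IsBicyclic (EdgeMostar.B5 m) m ∧ ¬ EdgeMostar.IsMaximizer (EdgeMostar.B5 m) m) ∧
    ¬ EdgeMostar.LiuConjecture := by
  refine ⟨fun V _ G m _ hG => ⟨hG.edgeMostar_five, hG.edgeMostar_six_to_eight,
    hG.edgeMostar_nine, hG.edgeMostar_ge_ten⟩, fun m hm => ⟨EdgeMostar.isMaximizer_B hm,
    EdgeMostar.isBicyclic_B5 (by omega), EdgeMostar.not_isMaximizer_B5 hm⟩, ?_⟩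
  rintro ⟨M, hM⟩
  exact EdgeMostar.not_isMaximizer_B5 (le_max_right M 10) (hM _ (le_max_left M 10)).2
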